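/- Let $d\in\{2,3\}$ and let $\mathcal D\subset\mathbb R^d$ be a bounded polyhedral domain with a conforming mesh of finitely many closed $d$-simplices $K$ (the elements) that fills $\overline{\mathcal D}$ and resolves $\partial\mathcal D$. Let $\mathrm{Re}\ge 0$, $\mathrm{Wi}>0$, $0\le\varepsilon<1$, $T>0$, $\Delta t=T/N_T$ with an integer $N_T\ge 1$, and $t^n=n\Delta t$. Discrete spaces: $(\mathbb P_2)^d$ is the space of continuous vector fields on $\overline{\mathcal D}$ that are polynomials of degree at most $2$ on each element and vanish on $\partial\mathcal D$; $\mathbb P_{1,disc}$ is the space of scalar fields that are polynomials of degree at most $1$ on each element, possibly discontinuous; $(\mathbb P_0)^{d(d+1)/2}$ is the space of symmetric-matrix-valued fields that are constant on each element. We write $(\nabla u)_{ij}=\partial_j u_i$ (computed elementwise), $\operatorname{div}u=\operatorname{tr}\nabla u$, and $A:B=\operatorname{tr}(AB^T)$. Let $(u_h^n,p_h^n,\psi_h^n)_{0\le n\le N_T}$ in $(\mathbb P_2)^d\times\mathbb P_{1,disc}\times(\mathbb P_0)^{d(d+1)/2}$ be a solution of the following scheme: for every $0\le n<N_T$ and every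 $(v,q,\phi)\in(\mathbb P_2)^d\times\mathbb P_{1,disc}\times(\mathbb P_0)^{d(d+1)/2}$, $$\begin{aligned}0=\int_{\mathcal D}\ &\mathrm{Re}\Big(\frac{u_h^{n+1}-u_h^n}{\Delta t}+u_h^n\cdot\nabla u_h^{n+1}\Big)\cdot v-p_h^{n+1}\operatorname{div}v+q\operatorname{div}u_h^{n+1}+(1-\varepsilon)\nabla u_h^{n+1}:\nabla v+\frac{\varepsilon}{\mathrm{Wi}}e^{\psi_h^{n+1}}:\nabla v\\&+\frac{\psi_h^{n+1}-\psi_h^n\circ X^n(t^n)}{\Delta t}:\phi-\big(\Omega_h^{n+1}\psi_h^{n+1}-\psi_h^{n+1}\Omega_h^{n+1}\big):\phi-2B_h^{n+1}:\phi-\frac1{\mathrm{Wi}}\big(e^{-\psi_h^{n+1}}-I\big):\phi .\end{aligned}$$ Here $X^n(t):\mathcal D\to\mathcal D$ is the backward flow of $u_h^n$: $\frac{d}{dt}X^n(t,x)=u_h^n(X^n(t,x))$ for $t\in[t^n,t^{n+1}]$ and $X^n(t^{n+1},x)=x$, for all $x\in\mathcal D$. The matrix fields $\Omega_h^{n+1},B_h^{n+1},N_h^{n+1}$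 have entries in $\mathbb P_{1,disc}$ and decompose the velocity gradient elementwise as $$\nabla u_h^{n+1}=\Omega_h^{n+1}+B_h^{n+1}+N_h^{n+1}e^{-\psi_h^{n+1}},$$ with $\Omega_h^{n+1},N_h^{n+1}$ antisymmetric and $B_h^{n+1}$ symmetric and commuting with $e^{\psi_h^{n+1}}$. Assume also that the initial velocity is discretely divergence free: $\int_{\mathcal D}q\operatorname{div}u_h^0=0$ for all $q\in\mathbb P_{1,disc}$. Then the free energy $$F_h^n=\frac{\mathrm{Re}}2\int_{\mathcal D}|u_h^n|^2+\frac{\varepsilon}{2\mathrm{Wi}}\int_{\mathcal D}\operatorname{tr}\big(e^{\psi_h^n}-\psi_h^n-I\big)$$ satisfies, for all $0\le n<N_T$, $$F_h^{n+1}-F_h^n+\int_{\mathcal D}\frac{\mathrm{Re}}2|u_h^{n+1}-u_h^n|^2+\Delta t\int_{\mathcal D}\Big((1-\varepsilon)|\nabla u_h^{n+1}|^2+\frac{\varepsilon}{2\mathrm{Wi}^2}\operatorname{tr}\big(e^{\psi_h^{n+1}}+e^{-\psi_h^{n+1}}-2I\big)\Big)\le 0 .$$ In particular, the sequence $(F_h^n)_{0\le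 n\le N_T}$ is non-increasing. (No positivity assumption on the discrete stress is needed.) -/

import Mathlib

open MeasureTheory Set

namespace LogConf

/-- Physical space `ℝᵈ` with its Euclidean norm and Lebesgue measure. -/
abbrev Space (d : ℕ) : Type := EuclideanSpace ℝ (Fin d)

/-- Tensors of rank two: real `d × d` matrices. -/
abbrev Tensor (d : ℕ) : Type := Matrix (Fin d) (Fin d) ℝ

noncomputable section

/-! ### Tensor calculus -/

/-- Double contraction `A : B = tr (A Bᵀ) = ∑ i j, A i j * B i j`. -/
def ddot {d : ℕ} (A B : Tensor d) : ℝ := (A * B.transpose).trace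

/-- The gradient `(∇u)ᵢⱼ = ∂uᵢ/∂xⱼ`, as a pointwise derivative. For a finite element field it is the
elementwise gradient, defined off the mesh skeleton (a null set). -/
def grad {d : ℕ} (u : Space d → Space d) (x : Space d) : Tensor d :=
  Matrix.of fun i j => fderiv ℝ u x (EuclideanSpace.single j 1) i

/-- The divergence `∑ i, ∂uᵢ/∂xᵢ`. -/
def div {d : ℕ} (u : Space d → Space d) (x : Space d) : ℝ := (grad u x).trace

/-! ### Meshes and finite element spaces -/

/-- A conforming simplicial mesh of the polyhedral set `D`: a finite simplicial complex, all of whose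
maximal simplices are `d`-dimensional, which fills the closure of `D` and resolves its boundary. -/
structure Mesh (d : ℕ) (D : Set (Space d)) where
  /-- the underlying simplicial complex -/
  complex : Geometry.SimplicialComplex ℝ (Space d)
  finite_faces : complex.faces.Finite
  card_facets : ∀ s ∈ complex.facets, s.card = d + 1
  space_eq : complex.space = closure D
  frontier_eq : ∃ F ⊆ complex.faces, frontier D = ⋃ s ∈ F, convexHull ℝ (s : Set (Space d))

/-- The (closed, `d`-dimensional) elements of the mesh. -/
def Mesh.elements {d : ℕ} {D : Set (Space d)} (M : Mesh d D) : Set (Set (Space d)) :=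
  {K | ∃ s ∈ M.complex.facets, K = convexHull ℝ (s : Set (Space d))}

/-- `ℙ_{k,disc}`: scalar fields that coincide, in the interior of each element, with a polynomial of
total degree at most `k`. The values on the mesh skeleton, a null set, are unconstrained. -/
def Mesh.Pdisc {d : ℕ} {D : Set (Space d)} (M : Mesh d D) (k : ℕ) : Set (Space d → ℝ) :=
  {f | ∀ K ∈ M.elements, ∃ P : MvPolynomial (Fin d) ℝ, P.totalDegree ≤ k ∧
    ∀ x ∈ interior K, f x = MvPolynomial.eval (fun i => x i) P}

/-- Tensor fields with entries in `ℙ_{k,disc}`. -/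
def Mesh.PdiscTensor {d : ℕ} {D : Set (Space d)} (M : Mesh d D) (k : ℕ) :
    Set (Space d → Tensor d) :=
  {A | ∀ i j, (fun x => A x i j) ∈ M.Pdisc k}

/-- `(ℙ₀)^{d(d+1)/2}`: piecewise constant fields of symmetric tensors. -/
def Mesh.P0Sym {d : ℕ} {D : Set (Space d)} (M : Mesh d D) : Set (Space d → Tensor d) :=
  {ψ | ψ ∈ M.PdiscTensor 0 ∧ ∀ K ∈ M.elements, ∀ x ∈ interior K, (ψ x).IsSymm}

/-- `(ℙ₂)ᵈ` with the no-slip condition: continuous, piecewise quadratic vector fields which vanish on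
the boundary of `D`. The values outside the closure of `D` are irrelevant. -/
def Mesh.P2Velocity {d : ℕ} {D : Set (Space d)} (M : Mesh d D) : Set (Space d → Space d) :=
  {v | ContinuousOn v (closure D) ∧ (∀ i, (fun x => v x i) ∈ M.Pdisc 2) ∧
    ∀ x ∈ frontier D, v x = 0}

/-- `(ℙ₂)ᵈ_{div = 0}`: the velocities whose divergence is orthogonal to every discrete pressure. -/
def Mesh.P2VelocityDivFree {d : ℕ} {D : Set (Space d)} (M : Mesh d D) :
    Set (Space d → Space d) :=
  {v | v ∈ M.P2Velocity ∧ ∀ q ∈ M.Pdisc 1, ∫ x in D, q x * div v x = 0}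

/-! ### The scheme -/

/-- `X` is the backward flow in `D` of the velocity field `w` over the time interval `[t₀, t₁]`:
`dX/dt (t, x) = w (X (t, x))` and `X (t₁, x) = x`, for all `x ∈ D`. -/
structure IsBackwardFlow {d : ℕ} (D : Set (Space d)) (w : Space d → Space d) (t₀ t₁ : ℝ)
    (X : ℝ → Space d → Space d) : Prop where
  mapsTo : ∀ t ∈ Icc t₀ t₁, ∀ x ∈ D, X t x ∈ D
  ode : ∀ x ∈ D, ∀ t ∈ Icc t₀ t₁,
    HasDerivWithinAt (fun s => X s x) (w (X t x)) (Icc t₀ t₁) t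
  final : ∀ x ∈ D, X t₁ x = x

/-- The elementwise decomposition `∇u = Ω + B + N e^{-ψ}`, where `Ω` and `N` are antisymmetric, `B` is
symmetric and commutes with `e^ψ`, and all three are piecewise affine. -/
structure IsDecomposition {d : ℕ} {D : Set (Space d)} (M : Mesh d D) (u : Space d → Space d)
    (ψ Ω B N : Space d → Tensor d) : Prop where
  Ω_mem : Ω ∈ M.PdiscTensor 1
  B_mem : B ∈ M.PdiscTensor 1
  N_mem : N ∈ M.PdiscTensor 1
  Ω_antisymm : ∀ K ∈ M.elements, ∀ x ∈ interior K, (Ω x).transpose = -Ω x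
  N_antisymm : ∀ K ∈ M.elements, ∀ x ∈ interior K, (N x).transpose = -N x
  B_symm : ∀ K ∈ M.elements, ∀ x ∈ interior K, (B x).IsSymm
  B_comm : ∀ K ∈ M.elements, ∀ x ∈ interior K, Commute (B x) (NormedSpace.exp (ψ x))
  eq : ∀ K ∈ M.elements, ∀ x ∈ interior K,
    grad u x = Ω x + B x + N x * NormedSpace.exp (-ψ x)

/-- The integral over `D` in the variational formulation of one time step of length `Δt`, from
`(u₀, ψ₀)` to `(u₁, p₁, ψ₁)`, tested with `(v, q, φ)`. Here `Y` is the foot of the characteristics and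
`fderiv ℝ u₁ x (u₀ x)` is the convective derivative `(u₀ · ∇u₁) (x)`. -/
def weakForm {d : ℕ} (D : Set (Space d)) (Re Wi ε Δt : ℝ)
    (u₀ u₁ : Space d → Space d) (p₁ : Space d → ℝ) (ψ₀ ψ₁ : Space d → Tensor d)
    (Y : Space d → Space d) (Ω B : Space d → Tensor d)
    (v : Space d → Space d) (q : Space d → ℝ) (φ : Space d → Tensor d) : ℝ :=
  ∫ x in D,
    (Re * inner ℝ (Δt⁻¹ • (u₁ x - u₀ x) + fderiv ℝ u₁ x (u₀ x)) (v x)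
      - p₁ x * div v x + q x * div u₁ x
      + (1 - ε) * ddot (grad u₁ x) (grad v x)
      + ε / Wi * ddot (NormedSpace.exp (ψ₁ x)) (grad v x)
      + ddot (Δt⁻¹ • (ψ₁ x - ψ₀ (Y x))) (φ x)
      - ddot (Ω x * ψ₁ x - ψ₁ x * Ω x) (φ x)
      - 2 * ddot (B x) (φ x)
      - 1 / Wi * ddot (NormedSpace.exp (-ψ₁ x) - 1) (φ x))

/-- `(u n, p n, ψ n)`, `0 ≤ n ≤ NT`, is a solution of the log-formulation scheme with Scott-Vogelius
velocity-pressure elements, piecewise constant `ψ`, and advection of `ψ` by characteristics, on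
`[0, T)` with time step `Δt = T / NT`. -/
structure IsSolution {d : ℕ} {D : Set (Space d)} (M : Mesh d D) (Re Wi ε T : ℝ) (NT : ℕ)
    (u : ℕ → Space d → Space d) (p : ℕ → Space d → ℝ) (ψ : ℕ → Space d → Tensor d) : Prop where
  u_mem : ∀ n ≤ NT, u n ∈ M.P2Velocity
  p_mem : ∀ n ≤ NT, p n ∈ M.Pdisc 1
  ψ_mem : ∀ n ≤ NT, ψ n ∈ M.P0Sym
  step : ∀ n < NT, ∃ (X : ℝ → Space d → Space d) (Ω B N : Space d → Tensor d),
    IsBackwardFlow D (u n) (n * (T / NT)) ((n + 1) * (T / NT)) X ∧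
    IsDecomposition M (u (n + 1)) (ψ (n + 1)) Ω B N ∧
    ∀ v ∈ M.P2Velocity, ∀ q ∈ M.Pdisc 1, ∀ φ ∈ M.P0Sym,
      weakForm D Re Wi ε (T / NT) (u n) (u (n + 1)) (p (n + 1)) (ψ n) (ψ (n + 1))
        (X (n * (T / NT))) Ω B v q φ = 0

/-- The free energy `F(u, e^ψ) = (Re/2) ∫ |u|² + (ε/(2 Wi)) ∫ tr (e^ψ - ψ - I)`. -/
def freeEnergy {d : ℕ} (D : Set (Space d)) (Re Wi ε : ℝ)
    (u : Space d → Space d) (ψ : Space d → Tensor d) : ℝ :=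
  Re / 2 * (∫ x in D, ‖u x‖ ^ 2)
    + ε / (2 * Wi) * (∫ x in D, (NormedSpace.exp (ψ x) - ψ x - 1).trace)

end

end LogConf

namespace LogConf

/-! ### Trace inequalities for exponentials of symmetric tensors -/

/-! The estimate comes from one choice of test functions: `v = u₁`, `q = p₁` and `φ = (ε / (2 * Wi))
• (exp ψ₁ - 1)`. This `φ` is admissible because `ψ₁` is constant on each element, so every symmetric
function of it is again in `P0Sym`. The pressure terms cancel, and four facts remain.

Incompressibility is pointwise: the divergence of a piecewise quadratic velocity is itself a
discrete pressure, so it can be tested against itself (`Mesh.div_ae_eq_zero`). With the no-slip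
condition, the convection term then integrates to zero (`Mesh.integral_convection_eq_zero`).

The stress terms are handled pointwise (`stress_balance_le`). The antisymmetric parts of the
decomposition have zero trace against symmetric functions of `ψ`, the two contributions of `B`
cancel, and the relaxation term is exactly the elastic dissipation. The difference quotient of `ψ`
is bounded below by Klein's inequality (`trace_exp_add_le`), i.e. convexity of `tr exp`.

This leaves the elastic energy of `ψ₀` at the feet of the characteristics. Its density is
nonnegative, so it suffices that the backward flow pushes Lebesgue measure on `D` to a measure at
most as large (`backwardFlow_aemeasurable_and_map_le`). The velocity is only Lipschitz, so the flow
need not be differentiable; its volume distortion is read off from explicit Euler steps. For a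
trace-free gradient one step of size `h` shrinks volume by at most a factor `1 - C * h ^ 2`, hence
`m` steps of size `τ / m` lose only `O(1 / m)`, and the iterates converge uniformly to the flow. -/

theorem ddot_eq_sum {d : ℕ} (A B : Tensor d) : ddot A B = ∑ i, ∑ j, A i j * B i j := by
  simp [ddot, Matrix.trace, Matrix.mul_apply]

theorem exists_orthogonal_diagonalization {d : ℕ} {A : Tensor d} (hA : A.IsSymm) :
    ∃ (U : Tensor d) (a : Fin d → ℝ), U * U.transpose = 1 ∧ U.transpose * U = 1 ∧
      A = U * Matrix.diagonal a * U.transpose ∧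
      NormedSpace.exp A = U * Matrix.diagonal (fun i => Real.exp (a i)) * U.transpose := by
  have hH : A.IsHermitian := by
    rw [Matrix.IsHermitian, Matrix.conjTranspose_eq_transpose_of_trivial]; exact hA
  set U : Tensor d := (hH.eigenvectorUnitary : Tensor d) with hU
  have hs : star U = U.transpose := by
    rw [Matrix.star_eq_conjTranspose, Matrix.conjTranspose_eq_transpose_of_trivial]
  have h1 : U * U.transpose = 1 := by
    rw [← hs]; exact Unitary.mul_star_self_of_mem hH.eigenvectorUnitary.2
  have h2 : U.transpose * U = 1 := by
    rw [← hs]; exact Unitary.star_mul_self_of_mem hH.eigenvectorUnitary.2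
  have h3 : A = U * Matrix.diagonal hH.eigenvalues * U.transpose := by
    have := hH.spectral_theorem
    rw [Unitary.conjStarAlgAut_apply] at this
    conv_lhs => rw [this]
    rw [← hU, ← hs]
    rfl
  refine ⟨U, hH.eigenvalues, h1, h2, h3, ?_⟩
  have hinv : U⁻¹ = U.transpose := Matrix.inv_eq_right_inv h1
  have hunit : IsUnit U := IsUnit.of_mul_eq_one _ h1
  conv_lhs => rw [h3, ← hinv, Matrix.exp_conj _ _ hunit, Matrix.exp_diagonal, hinv]
  congr 3
  ext i
  rw [Pi.coe_exp, Real.exp_eq_exp_ℝ]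

/-- The squared overlaps of two eigenbases act as nonnegative weights, so a scalar inequality
between eigenvalues sums up to a trace inequality for matrices that need not commute. -/
theorem trace_conj_diagonal_mul {d : ℕ} (U V : Tensor d) (f g : Fin d → ℝ) :
    ((U * Matrix.diagonal f * U.transpose) * (V * Matrix.diagonal g * V.transpose)).trace
      = ∑ i, ∑ j, (U.transpose * V) i j ^ 2 * (f i * g j) := by
  have h : ((U * Matrix.diagonal f * U.transpose) * (V * Matrix.diagonal g * V.transpose)).trace
      = ((Matrix.diagonal f * (U.transpose * V)) *
          (Matrix.diagonal g * (U.transpose * V).transpose)).trace := by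
    rw [Matrix.transpose_mul, Matrix.transpose_transpose]
    simp only [Matrix.mul_assoc]
    rw [Matrix.trace_mul_comm U]
    simp only [Matrix.mul_assoc]
  rw [h]
  simp only [Matrix.trace, Matrix.diag_apply, Matrix.mul_apply (N := Matrix.diagonal g * _),
    Matrix.diagonal_mul, Matrix.transpose_apply]
  refine Finset.sum_congr rfl fun i _ => Finset.sum_congr rfl fun j _ => ?_
  ring

/-- Klein's inequality for the exponential. -/
theorem trace_exp_add_le {d : ℕ} {A B : Tensor d} (hA : A.IsSymm) (hB : B.IsSymm) :
    (NormedSpace.exp A).trace + ((B - A) * NormedSpace.exp A).trace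
      ≤ (NormedSpace.exp B).trace := by
  obtain ⟨U, a, hU1, hU2, hA, heA⟩ := exists_orthogonal_diagonalization hA
  obtain ⟨V, b, hV1, hV2, hB, heB⟩ := exists_orthogonal_diagonalization hB
  have hu : U * Matrix.diagonal (fun _ => (1 : ℝ)) * U.transpose = 1 := by
    rw [Matrix.diagonal_one, Matrix.mul_one, hU1]
  have hv : V * Matrix.diagonal (fun _ => (1 : ℝ)) * V.transpose = 1 := by
    rw [Matrix.diagonal_one, Matrix.mul_one, hV1]
  -- Pairing with the constant function 1 writes every trace over the same weights, so that the
  -- claim can be checked term by term.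
  have e1 := trace_conj_diagonal_mul U V (fun i => Real.exp (a i)) (fun _ => 1)
  have e2 := trace_conj_diagonal_mul U V (fun _ => 1) (fun i => Real.exp (b i))
  have e3 := trace_conj_diagonal_mul U V (fun i => Real.exp (a i)) b
  have e4 := trace_conj_diagonal_mul U V (fun i => a i * Real.exp (a i)) (fun _ => 1)
  have e5 : A * NormedSpace.exp A
      = U * Matrix.diagonal (fun i => a i * Real.exp (a i)) * U.transpose := by
    rw [heA]
    conv_lhs => rw [hA]
    rw [← Matrix.diagonal_mul_diagonal]
    calc _ = U * Matrix.diagonal a * (U.transpose * U) *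
          Matrix.diagonal (fun i => Real.exp (a i)) * U.transpose := by
            simp only [Matrix.mul_assoc]
      _ = _ := by rw [hU2]; simp only [Matrix.mul_assoc, Matrix.mul_one]
  rw [← heA, hv, Matrix.mul_one] at e1
  rw [← heB, hu, Matrix.one_mul] at e2
  rw [← heA, ← hB, Matrix.trace_mul_comm] at e3
  rw [← e5, hv, Matrix.mul_one] at e4
  rw [Matrix.sub_mul, Matrix.trace_sub, e1, e2, e3, e4, ← Finset.sum_sub_distrib,
    ← Finset.sum_add_distrib]
  refine Finset.sum_le_sum fun i _ => ?_
  rw [← Finset.sum_sub_distrib, ← Finset.sum_add_distrib]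
  refine Finset.sum_le_sum fun j _ => ?_
  -- The scalar inequality is the tangent line bound for `exp` at `a i`.
  have h := Real.add_one_le_exp (b j - a i)
  have h2 : Real.exp (b j) = Real.exp (a i) * Real.exp (b j - a i) := by
    rw [← Real.exp_add]; congr 1; ring
  rw [h2]
  have h3 := mul_nonneg (mul_nonneg (sq_nonneg ((U.transpose * V) i j)) (Real.exp_pos (a i)).le)
    (sub_nonneg.2 h)
  nlinarith [h3]

theorem trace_exp_sub_sub_one_nonneg {d : ℕ} {A : Tensor d} (hA : A.IsSymm) :
    0 ≤ (NormedSpace.exp A - A - 1).trace := by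
  have h := trace_exp_add_le (A := (0 : Tensor d)) Matrix.isSymm_zero hA
  rw [NormedSpace.exp_zero, sub_zero, mul_one] at h
  rw [Matrix.trace_sub, Matrix.trace_sub]
  linarith

theorem trace_exp_add_exp_neg_nonneg {d : ℕ} {A : Tensor d} (hA : A.IsSymm) :
    0 ≤ (NormedSpace.exp A + NormedSpace.exp (-A) - (2 : ℝ) • (1 : Tensor d)).trace := by
  have h1 := trace_exp_sub_sub_one_nonneg hA
  have h2 := trace_exp_sub_sub_one_nonneg (A := -A) (by
    rw [Matrix.IsSymm, Matrix.transpose_neg, hA.eq])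
  simp only [Matrix.trace_sub, Matrix.trace_add, Matrix.trace_neg, Matrix.trace_smul,
    smul_eq_mul] at *
  linarith

theorem isSymm_exp {d : ℕ} {A : Tensor d} (hA : A.IsSymm) :
    (NormedSpace.exp A : Tensor d).IsSymm := by
  rw [Matrix.IsSymm, ← Matrix.exp_transpose, hA.eq]

theorem exp_mul_exp_neg {d : ℕ} (A : Tensor d) :
    (NormedSpace.exp A : Tensor d) * NormedSpace.exp (-A) = 1 := by
  rw [← Matrix.exp_add_of_commute _ _ (Commute.refl A).neg_right, add_neg_cancel,
    NormedSpace.exp_zero]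

theorem exp_neg_mul_exp {d : ℕ} (A : Tensor d) :
    (NormedSpace.exp (-A) : Tensor d) * NormedSpace.exp A = 1 := by
  simpa using exp_mul_exp_neg (-A)

theorem commute_exp_self {d : ℕ} (A : Tensor d) : A * NormedSpace.exp A = NormedSpace.exp A * A := by
  let _ : NormedRing (Tensor d) := Matrix.linftyOpNormedRing
  let _ : NormedAlgebra ℝ (Tensor d) := Matrix.linftyOpNormedAlgebra
  let _ : NormedAlgebra ℚ (Tensor d) := NormedAlgebra.restrictScalars ℚ ℝ _
  exact ((Commute.refl A).exp_right).eq

theorem trace_antisymm_mul_symm {d : ℕ} {Ω S : Tensor d} (hΩ : Ω.transpose = -Ω) (hS : S.IsSymm) :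
    (Ω * S).trace = 0 := by
  have h : (Ω * S).trace = -(Ω * S).trace := by
    conv_lhs => rw [← Matrix.trace_transpose, Matrix.transpose_mul, hΩ, hS.eq, Matrix.mul_neg,
      Matrix.trace_neg, Matrix.trace_mul_comm]
  linarith

theorem ddot_of_isSymm {d : ℕ} (A : Tensor d) {B : Tensor d} (hB : B.IsSymm) :
    ddot A B = (A * B).trace := by rw [ddot, hB.eq]

theorem ddot_comm {d : ℕ} (A B : Tensor d) : ddot A B = ddot B A := by
  simp only [ddot_eq_sum, mul_comm]

/-- The local free energy balance of the log-conformation equation. -/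
theorem stress_balance_le {d : ℕ} {ψ ψ₀ Ω B N G : Tensor d} {ε Wi δ : ℝ} (hε : 0 ≤ ε)
    (hWi : 0 < Wi) (hδ : 0 ≤ δ) (hψ : ψ.IsSymm) (hψ₀ : ψ₀.IsSymm)
    (hΩ : Ω.transpose = -Ω) (hN : N.transpose = -N)
    (hG : G = Ω + B + N * NormedSpace.exp (-ψ)) (hdiv : G.trace = 0) :
    ε / (2 * Wi) * δ * ((NormedSpace.exp ψ - ψ - 1).trace - (NormedSpace.exp ψ₀ - ψ₀ - 1).trace)
      + ε / (2 * Wi ^ 2) *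
        (NormedSpace.exp ψ + NormedSpace.exp (-ψ) - (2 : ℝ) • (1 : Tensor d)).trace
    ≤ ε / Wi * ddot (NormedSpace.exp ψ) G
      + ddot (δ • (ψ - ψ₀)) ((ε / (2 * Wi)) • (NormedSpace.exp ψ - 1))
      - ddot (Ω * ψ - ψ * Ω) ((ε / (2 * Wi)) • (NormedSpace.exp ψ - 1))
      - 2 * ddot B ((ε / (2 * Wi)) • (NormedSpace.exp ψ - 1))
      - 1 / Wi * ddot (NormedSpace.exp (-ψ) - 1) ((ε / (2 * Wi)) • (NormedSpace.exp ψ - 1)) := by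
  set E : Tensor d := NormedSpace.exp ψ with hE
  set E' : Tensor d := NormedSpace.exp (-ψ) with hE'
  have hEs : E.IsSymm := isSymm_exp hψ
  have hψn : (-ψ).IsSymm := by rw [Matrix.IsSymm, Matrix.transpose_neg, hψ.eq]
  have hE's : E'.IsSymm := isSymm_exp hψn
  have hφ : ((ε / (2 * Wi)) • (E - 1)).IsSymm := (hEs.sub Matrix.isSymm_one).smul _
  have hEE' : E' * E = 1 := exp_neg_mul_exp ψ
  have t1 : (Ω * E).trace = 0 := trace_antisymm_mul_symm hΩ hEs
  have t2 : (N * E').trace = 0 := trace_antisymm_mul_symm hN hE's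
  have t3 : N.trace = 0 := by simpa using trace_antisymm_mul_symm hN Matrix.isSymm_one
  have t4 : Ω.trace = 0 := by simpa using trace_antisymm_mul_symm hΩ Matrix.isSymm_one
  have t5 : B.trace = 0 := by
    rw [hG, Matrix.trace_add, Matrix.trace_add] at hdiv
    linarith
  -- The `Ω` part dies against the symmetric `E`; the `N` part loses its exponential because `E' * E
  -- = 1`, leaving the trace of an antisymmetric matrix.
  have g1 : ddot E G = (B * E).trace := by
    rw [ddot_comm, ddot_of_isSymm _ hEs, hG, Matrix.add_mul, Matrix.add_mul, Matrix.mul_assoc N,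
      hEE', Matrix.mul_one, Matrix.trace_add, Matrix.trace_add, t1, t3]
    ring
  -- The commutator with `ψ` is trace-orthogonal to everything that commutes with `ψ`, in particular
  -- to `E - 1`.
  have g2 : ((Ω * ψ - ψ * Ω) * (E - 1)).trace = 0 := by
    have c1 : (ψ * Ω * E).trace = (Ω * ψ * E).trace := by
      rw [Matrix.mul_assoc, Matrix.trace_mul_comm, Matrix.mul_assoc, Matrix.mul_assoc,
        commute_exp_self]
    rw [Matrix.sub_mul, Matrix.mul_sub, Matrix.mul_sub, Matrix.mul_one, Matrix.mul_one,
      Matrix.trace_sub, Matrix.trace_sub, Matrix.trace_sub, c1, Matrix.trace_mul_comm ψ Ω]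
    ring
  have g3 : ((E' - 1) * (E - 1)).trace
      = -(E + E' - (2 : ℝ) • (1 : Tensor d)).trace := by
    have : (E' - 1) * (E - 1) = -(E + E' - (2 : ℝ) • (1 : Tensor d)) := by
      rw [sub_mul, mul_sub, hEE', two_smul]
      simp only [mul_one, one_mul]
      abel
    rw [this, Matrix.trace_neg]
  have g4 : (B * (E - 1)).trace = (B * E).trace := by
    rw [Matrix.mul_sub, Matrix.mul_one, Matrix.trace_sub, t5, sub_zero]
  have g5 : (E - ψ - 1).trace - (NormedSpace.exp ψ₀ - ψ₀ - 1).trace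
      ≤ ((ψ - ψ₀) * (E - 1)).trace := by
    have k := trace_exp_add_le hψ hψ₀
    rw [← hE] at k
    simp only [Matrix.trace_sub, Matrix.sub_mul, Matrix.mul_sub, Matrix.mul_one] at k ⊢
    linarith
  rw [g1, ddot_of_isSymm _ hφ, ddot_of_isSymm _ hφ, ddot_of_isSymm _ hφ, ddot_of_isSymm _ hφ]
  simp only [Matrix.mul_smul, Matrix.smul_mul, Matrix.trace_smul, g2, g3, g4, smul_eq_mul]
  have key := mul_le_mul_of_nonneg_left g5 (mul_nonneg (by positivity : 0 ≤ ε / (2 * Wi)) hδ)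
  -- The factor `1/2` in the test tensor is what makes `-2 B : φ` cancel the power of the stress, `ε
  -- / Wi * (B * E).trace`.
  have r1 : ε / Wi * (B * E).trace = 2 * (ε / (2 * Wi) * (B * E).trace) := by
    field_simp
  have r2 : ε / (2 * Wi ^ 2) = 1 / Wi * (ε / (2 * Wi)) := by field_simp
  rw [r1, r2]
  nlinarith [key]

end LogConf

namespace LogConf

noncomputable section

/-! ### Lipschitz continuity from a finite closed cover -/

-- Along a segment, the slope of `‖f - f x‖` is at most `C` times the length whenever two nearby
-- points share a set of the cover, and the mean value inequality for lower right slopes needs this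
-- only for points arbitrarily close on the right. This glues elementwise bounds together without
-- convexity of the domain.
open Filter Topology in
theorem lipschitzWith_of_finite_closed_cover {E F : Type*} [NormedAddCommGroup E]
    [NormedSpace ℝ E] [NormedAddCommGroup F] [NormedSpace ℝ F] {f : E → F} {C : NNReal}
    {S : Set (Set E)} (hS : S.Finite) (hclosed : ∀ A ∈ S, IsClosed A)
    (hcover : ∀ x, ∃ A ∈ S, x ∈ A) (hf : ∀ A ∈ S, LipschitzOnWith C f A) :
    LipschitzWith C f := by
  have hcont : Continuous f := by
    have : Finite S := hS
    refine LocallyFinite.continuous (f := fun A : S => (A : Set E)) (locallyFinite_of_finite _)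
      ?_ (fun A => hclosed A A.2) (fun A => (hf A A.2).continuousOn)
    refine eq_univ_of_forall fun x => ?_
    obtain ⟨A, hA, hx⟩ := hcover x
    exact mem_iUnion.2 ⟨⟨A, hA⟩, hx⟩
  refine LipschitzWith.of_dist_le_mul fun y x => ?_
  rw [dist_eq_norm, dist_eq_norm]
  set γ : ℝ → E := fun t => x + t • (y - x) with hγ
  have hγc : Continuous γ := by fun_prop
  have hγd : ∀ s t, ‖γ s - γ t‖ = |s - t| * ‖y - x‖ := by
    intro s t
    have : γ s - γ t = (s - t) • (y - x) := by simp only [hγ, sub_smul]; abel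
    rw [this, norm_smul, Real.norm_eq_abs]
  refine le_of_forall_pos_le_add fun δ hδ => ?_
  have key := image_norm_le_of_liminf_right_slope_norm_lt_deriv_boundary (a := 0) (b := 1)
    (f := fun t => f (γ t) - f x) (f' := fun _ => C * ‖y - x‖)
    -- The slack `δ` supplies the strict inequality between slopes that the comparison principle
    -- requires.
    (B := fun t => (C * ‖y - x‖ + δ) * t) (B' := fun _ => C * ‖y - x‖ + δ)
    (by fun_prop) ?_ (by simp [hγ]) (by fun_prop) ?_ ?_ (right_mem_Icc.2 zero_le_one)
  · simpa [hγ] using key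
  · intro t _ r hr
    -- Pigeonhole: finitely many sets cover the points just after `t`, so one of them recurs
    -- arbitrarily close to `t`, and being closed it contains `γ t`.
    have hex : ∃ A ∈ S, ∃ᶠ z in 𝓝[>] t, γ z ∈ A := by
      by_contra hcon
      push Not at hcon
      have h1 : ∀ᶠ z in 𝓝[>] t, ∀ A ∈ S, γ z ∉ A :=
        (eventually_all_finite hS).2 fun A hA => hcon A hA
      obtain ⟨z, hz⟩ := h1.exists
      obtain ⟨A, hA, hzA⟩ := hcover (γ z)
      exact hz A hA hzA
    obtain ⟨A, hA, hfreq⟩ := hex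
    have htA : γ t ∈ A := (hclosed A hA).mem_of_frequently_of_tendsto hfreq
      (hγc.continuousAt.tendsto.mono_left nhdsWithin_le_nhds)
    refine (hfreq.and_eventually self_mem_nhdsWithin).mono ?_
    rintro z ⟨hzA, hzt⟩
    have hzt' : 0 < z - t := sub_pos.2 hzt
    rw [slope_def_field, div_lt_iff₀ hzt']
    have h1 : ‖f (γ z) - f (γ t)‖ ≤ C * ((z - t) * ‖y - x‖) := by
      have := (hf A hA).dist_le_mul _ hzA _ htA
      rwa [dist_eq_norm, dist_eq_norm, hγd, abs_of_pos hzt'] at this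
    have h2 : ‖f (γ z) - f x‖ - ‖f (γ t) - f x‖ ≤ ‖f (γ z) - f (γ t)‖ := by
      have := norm_sub_norm_le (f (γ z) - f x) (f (γ t) - f x)
      rwa [sub_sub_sub_cancel_right] at this
    have h3 := mul_lt_mul_of_pos_right hr hzt'
    simp only [Function.comp_apply]
    nlinarith
  · intro t _
    simpa using ((hasDerivAt_id t).const_mul (C * ‖y - x‖ + δ)).hasDerivWithinAt
  · intro t _ _
    linarith

/-! ### Polynomial fields -/

/-- The drop in degree puts the divergence of a quadratic velocity into the pressure space. -/
theorem totalDegree_pderiv_le {σ R : Type*} [CommSemiring R] (i : σ) (P : MvPolynomial σ R) :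
    (MvPolynomial.pderiv i P).totalDegree ≤ P.totalDegree - 1 := by
  classical
  rw [MvPolynomial.totalDegree, Finset.sup_le_iff]
  intro m hm
  rw [MvPolynomial.mem_support_iff, MvPolynomial.coeff_pderiv] at hm
  have h := MvPolynomial.le_totalDegree (MvPolynomial.mem_support_iff.2 (left_ne_zero_of_mul hm))
  rw [Finsupp.sum_add_index' (fun _ => rfl) (fun _ _ _ => rfl),
    Finsupp.sum_single_index rfl] at h
  omega

/-- The polynomial function on `ℝᵈ` attached to a polynomial. -/
def polyFun {d : ℕ} (P : MvPolynomial (Fin d) ℝ) (x : Space d) : ℝ :=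
  MvPolynomial.eval (fun i => x i) P

theorem continuous_polyFun {d : ℕ} (P : MvPolynomial (Fin d) ℝ) : Continuous (polyFun P) :=
  (MvPolynomial.continuous_eval P).comp (by fun_prop)

theorem hasFDerivAt_polyFun {d : ℕ} (P : MvPolynomial (Fin d) ℝ) (x : Space d) :
    HasFDerivAt (polyFun P)
      (∑ i, polyFun (MvPolynomial.pderiv i P) x • (EuclideanSpace.proj i : Space d →L[ℝ] ℝ)) x := by
  induction P using MvPolynomial.induction_on with
  | C a =>
    have h : polyFun (MvPolynomial.C a) = fun _ : Space d => a := by ext; simp [polyFun]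
    rw [h]
    exact (hasFDerivAt_const a x).congr_fderiv (by simp [polyFun])
  | add P Q hP hQ =>
    have h : polyFun (P + Q) = fun y : Space d => polyFun P y + polyFun Q y := by
      ext; simp [polyFun]
    rw [h]
    refine (hP.add hQ).congr_fderiv ?_
    rw [← Finset.sum_add_distrib]
    refine Finset.sum_congr rfl fun i _ => ?_
    rw [← add_smul]
    simp [polyFun]
  | mul_X P j hP =>
    have h : polyFun (P * MvPolynomial.X j) =
        fun y : Space d => polyFun P y * (EuclideanSpace.proj j : Space d →L[ℝ] ℝ) y := by
      ext; simp [polyFun]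
    rw [h]
    refine (hP.mul (EuclideanSpace.proj j : Space d →L[ℝ] ℝ).hasFDerivAt).congr_fderiv ?_
    ext v
    simp only [polyFun, MvPolynomial.pderiv_X, Pi.single_apply, add_mul, Finset.sum_add_distrib,
      Finset.mul_sum, sum_apply, smul_apply, add_apply, MvPolynomial.pderiv_mul,
      map_add, map_mul, MvPolynomial.eval_X, PiLp.proj_apply, smul_eq_mul]
    rw [add_comm]
    congr 1
    · refine Finset.sum_congr rfl fun i _ => ?_
      ring
    · simp [apply_ite]

/-- The vector field on `ℝᵈ` with polynomial components. -/
def polyField {d : ℕ} (P : Fin d → MvPolynomial (Fin d) ℝ) (x : Space d) : Space d :=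
  WithLp.toLp 2 fun i => polyFun (P i) x

/-- The derivative of a polynomial vector field. -/
def polyFieldDeriv {d : ℕ} (P : Fin d → MvPolynomial (Fin d) ℝ) (x : Space d) :
    Space d →L[ℝ] Space d :=
  (EuclideanSpace.equiv (Fin d) ℝ).symm.toContinuousLinearMap.comp
    (ContinuousLinearMap.pi fun i => ∑ j, polyFun (MvPolynomial.pderiv j (P i)) x •
      (EuclideanSpace.proj j : Space d →L[ℝ] ℝ))

theorem hasFDerivAt_polyField {d : ℕ} (P : Fin d → MvPolynomial (Fin d) ℝ) (x : Space d) :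
    HasFDerivAt (polyField P) (polyFieldDeriv P x) x :=
  (EuclideanSpace.equiv (Fin d) ℝ).symm.toContinuousLinearMap.hasFDerivAt.comp x
    (hasFDerivAt_pi.2 fun i => hasFDerivAt_polyFun (P i) x)

theorem continuous_polyField {d : ℕ} (P : Fin d → MvPolynomial (Fin d) ℝ) :
    Continuous (polyField P) :=
  continuous_iff_continuousAt.2 fun x => (hasFDerivAt_polyField P x).continuousAt

theorem continuous_polyFieldDeriv {d : ℕ} (P : Fin d → MvPolynomial (Fin d) ℝ) :
    Continuous (polyFieldDeriv P) := by
  refine continuous_clm_apply.2 fun v => ?_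
  have : ∀ i j, Continuous (polyFun (MvPolynomial.pderiv j (P i))) :=
    fun i j => continuous_polyFun _
  simp only [polyFieldDeriv, ContinuousLinearMap.comp_apply]
  refine (EuclideanSpace.equiv (Fin d) ℝ).symm.continuous.comp (continuous_pi fun i => ?_)
  simp only [ContinuousLinearMap.coe_pi', sum_apply, smul_apply]
  fun_prop

theorem polyFieldDeriv_single {d : ℕ} (P : Fin d → MvPolynomial (Fin d) ℝ) (x : Space d)
    (i j : Fin d) :
    polyFieldDeriv P x (EuclideanSpace.single j 1) i
      = polyFun (MvPolynomial.pderiv j (P i)) x := by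
  simp [polyFieldDeriv]

/-! ### Geometry of the mesh -/

variable {d : ℕ} {D : Set (Space d)} (M : Mesh d D)

theorem Mesh.elements_finite : M.elements.Finite := by
  have h : M.elements = (fun s : Finset (Space d) => convexHull ℝ (s : Set (Space d))) ''
      M.complex.facets := by
    ext K
    simp only [Mesh.elements, mem_ofPred_eq, mem_image]
    exact ⟨fun ⟨s, hs, h⟩ => ⟨s, hs, h.symm⟩, fun ⟨s, hs, h⟩ => ⟨s, hs, h.symm⟩⟩
  rw [h]
  exact (M.finite_faces.subset fun _ hs => hs.1).image _

theorem Mesh.convex_element {K : Set (Space d)} (hK : K ∈ M.elements) : Convex ℝ K := by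
  obtain ⟨s, -, rfl⟩ := hK
  exact convex_convexHull ℝ _

theorem Mesh.isCompact_element {K : Set (Space d)} (hK : K ∈ M.elements) : IsCompact K := by
  obtain ⟨s, -, rfl⟩ := hK
  exact s.finite_toSet.isCompact_convexHull (𝕜 := ℝ)

theorem Mesh.interior_element_nonempty {K : Set (Space d)} (hK : K ∈ M.elements) :
    (interior K).Nonempty := by
  obtain ⟨s, hs, rfl⟩ := hK
  rw [interior_convexHull_nonempty_iff_affineSpan_eq_top]
  have hind := M.complex.indep hs.1
  have h := (hind.affineSpan_eq_top_iff_card_eq_finrank_add_one (k := ℝ)).2 (by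
    rw [Fintype.card_coe, M.card_facets s hs, finrank_euclideanSpace_fin])
  simpa using h

theorem Mesh.closure_interior_element {K : Set (Space d)} (hK : K ∈ M.elements) :
    closure (interior K) = K := by
  rw [(M.convex_element hK).closure_interior_eq_closure_of_nonempty_interior
    (M.interior_element_nonempty hK), (M.isCompact_element hK).isClosed.closure_eq]

theorem Mesh.element_subset {K : Set (Space d)} (hK : K ∈ M.elements) : K ⊆ closure D := by
  obtain ⟨s, hs, rfl⟩ := hK
  rw [← M.space_eq]
  exact M.complex.convexHull_subset_space hs.1

theorem Mesh.exists_mem_element {x : Space d} (hx : x ∈ closure D) : ∃ K ∈ M.elements, x ∈ K := by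
  rw [← M.space_eq, Geometry.SimplicialComplex.mem_space_iff] at hx
  obtain ⟨s, hs, hx⟩ := hx
  obtain ⟨t, hst, ht⟩ := M.finite_faces.exists_le_maximal hs
  refine ⟨_, ⟨t, ⟨ht.1, fun r hr htr => ?_⟩, rfl⟩, convexHull_mono (Finset.coe_subset.2 hst) hx⟩
  exact le_antisymm htr (ht.2 hr htr)

theorem Mesh.isCompact_closure (M : Mesh d D) : IsCompact (closure D) := by
  have h : closure D = ⋃ K ∈ M.elements, K := by
    refine Subset.antisymm (fun x hx => ?_) (iUnion₂_subset fun K hK => M.element_subset hK)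
    obtain ⟨K, hK, hx⟩ := M.exists_mem_element hx
    exact mem_biUnion hK hx
  rw [h]
  exact M.elements_finite.isCompact_biUnion fun K hK => M.isCompact_element hK

/-- The frontier of an open set has empty interior, hence so does each simplex in it; a closed
convex set with empty interior equals its own frontier, which is null. -/
theorem Mesh.volume_frontier (M : Mesh d D) (hD : IsOpen D) : volume (frontier D) = 0 := by
  obtain ⟨F, hF, h⟩ := M.frontier_eq
  rw [h, measure_biUnion_null_iff (M.finite_faces.subset hF).countable]
  intro s hs
  have hconv := convex_convexHull ℝ (s : Set (Space d))
  have hcl : IsClosed (convexHull ℝ (s : Set (Space d))) :=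
    (s.finite_toSet.isCompact_convexHull (𝕜 := ℝ)).isClosed
  have hint : interior (convexHull ℝ (s : Set (Space d))) = ∅ := by
    refine subset_empty_iff.1 ?_
    rw [← interior_frontier hD.isClosed_compl, frontier_compl, h]
    exact interior_mono (subset_biUnion_of_mem (u := fun s : Finset (Space d) =>
      convexHull ℝ (s : Set (Space d))) hs)
  have := hconv.addHaar_frontier volume
  rwa [hcl.frontier_eq, hint, sdiff_empty] at this

theorem Mesh.ae_mem_interior (D' : Set (Space d)) (hD' : D' ⊆ closure D) :
    ∀ᵐ x, x ∈ D' → ∃ K ∈ M.elements, x ∈ interior K := by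
  have h : ∀ᵐ x : Space d, ∀ K ∈ M.elements, x ∉ frontier K := by
    refine (ae_ball_iff M.elements_finite.countable).2 fun K hK => ?_
    exact measure_eq_zero_iff_ae_notMem.1 ((M.convex_element hK).addHaar_frontier volume)
  filter_upwards [h] with x hx hxD
  obtain ⟨K, hK, hxK⟩ := M.exists_mem_element (hD' hxD)
  refine ⟨K, hK, ?_⟩
  by_contra hni
  exact hx K hK ⟨subset_closure hxK, hni⟩

theorem Mesh.ae_restrict_mem_interior (hD : IsOpen D) :
    ∀ᵐ x ∂volume.restrict D, ∃ K ∈ M.elements, x ∈ interior K :=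
  (ae_restrict_iff' hD.measurableSet).2 (M.ae_mem_interior D subset_closure)

/-! ### Piecewise continuous fields -/

/-- Fields that extend, from the interior of each element, to a continuous function. -/
def Mesh.PiecewiseContinuous {E : Type*} [TopologicalSpace E] (f : Space d → E) : Prop :=
  ∀ K ∈ M.elements, ∃ g : Space d → E, Continuous g ∧ EqOn f g (interior K)

namespace Mesh.PiecewiseContinuous

variable {M} {E F G : Type*} [TopologicalSpace E] [TopologicalSpace F] [TopologicalSpace G]

theorem comp {f : Space d → E} (hf : M.PiecewiseContinuous f) {φ : E → F} (hφ : Continuous φ) :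
    M.PiecewiseContinuous fun x => φ (f x) := by
  intro K hK
  obtain ⟨g, hg, h⟩ := hf K hK
  exact ⟨fun x => φ (g x), hφ.comp hg, fun x hx => congrArg φ (h hx)⟩

theorem comp₂ {f : Space d → E} {g : Space d → F} (hf : M.PiecewiseContinuous f)
    (hg : M.PiecewiseContinuous g) {φ : E → F → G} (hφ : Continuous fun p : E × F => φ p.1 p.2) :
    M.PiecewiseContinuous fun x => φ (f x) (g x) := by
  intro K hK
  obtain ⟨f', hf', h⟩ := hf K hK
  obtain ⟨g', hg', h'⟩ := hg K hK
  exact ⟨fun x => φ (f' x) (g' x), hφ.comp (hf'.prodMk hg'), fun x hx => by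
    simp only [h hx, h' hx]⟩

theorem pi {ι : Type*} {f : Space d → ι → E}
    (hf : ∀ i, M.PiecewiseContinuous fun x => f x i) : M.PiecewiseContinuous f := by
  intro K hK
  choose g hg h using fun i => hf i K hK
  exact ⟨fun x i => g i x, continuous_pi hg, fun x hx => funext fun i => h i hx⟩

theorem integrableOn {E : Type*} [NormedAddCommGroup E] {f : Space d → E}
    (hf : M.PiecewiseContinuous f) : IntegrableOn f D := by
  have h : IntegrableOn f (⋃ K ∈ M.elements, interior K) := by
    rw [integrableOn_finite_biUnion M.elements_finite]
    intro K hK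
    obtain ⟨g, hg, h⟩ := hf K hK
    exact ((hg.continuousOn.integrableOn_compact (M.isCompact_element hK)).mono_set
      interior_subset).congr_fun h.symm isOpen_interior.measurableSet
  refine h.mono_set_ae ?_
  filter_upwards [M.ae_mem_interior D subset_closure] with x hx hxD
  obtain ⟨K, hK, hxK⟩ := hx hxD
  exact mem_biUnion hK hxK

theorem ae_bounded {E : Type*} [NormedAddCommGroup E] {f : Space d → E}
    (hf : M.PiecewiseContinuous f) (hD : IsOpen D) :
    ∃ C, ∀ᵐ x ∂volume.restrict D, ‖f x‖ ≤ C := by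
  have h : ∀ K ∈ M.elements, ∃ C, ∀ x ∈ interior K, ‖f x‖ ≤ C := by
    intro K hK
    obtain ⟨g, hg, h⟩ := hf K hK
    obtain ⟨C, hC⟩ := (M.isCompact_element hK).exists_bound_of_continuousOn hg.continuousOn
    exact ⟨C, fun x hx => by rw [h hx]; exact hC x (interior_subset hx)⟩
  choose! C hC using h
  obtain ⟨B, hB⟩ := (M.elements_finite.image C).bddAbove
  refine ⟨B, ?_⟩
  filter_upwards [M.ae_restrict_mem_interior hD] with x hx
  obtain ⟨K, hK, hxK⟩ := hx
  exact (hC K hK x hxK).trans (hB (mem_image_of_mem _ hK))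

end Mesh.PiecewiseContinuous

/-! ### Finite element fields -/

variable {M}

theorem Mesh.piecewiseContinuous_of_mem_Pdisc {k : ℕ} {f : Space d → ℝ} (hf : f ∈ M.Pdisc k) :
    M.PiecewiseContinuous f := by
  intro K hK
  obtain ⟨P, -, h⟩ := hf K hK
  exact ⟨polyFun P, continuous_polyFun P, h⟩

theorem Mesh.piecewiseContinuous_of_mem_PdiscTensor {k : ℕ} {A : Space d → Tensor d}
    (hA : A ∈ M.PdiscTensor k) : M.PiecewiseContinuous A :=
  .pi fun i => .pi fun j => M.piecewiseContinuous_of_mem_Pdisc (hA i j)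

theorem Mesh.exists_eqOn_const_of_mem_P0Sym {ψ : Space d → Tensor d} (hψ : ψ ∈ M.P0Sym)
    {K : Set (Space d)} (hK : K ∈ M.elements) :
    ∃ A : Tensor d, A.IsSymm ∧ ∀ x ∈ interior K, ψ x = A := by
  obtain ⟨y, hy⟩ := M.interior_element_nonempty hK
  refine ⟨ψ y, hψ.2 K hK y hy, fun x hx => ?_⟩
  ext i j
  obtain ⟨P, hP, h⟩ := hψ.1 i j K hK
  rw [MvPolynomial.totalDegree_eq_zero_iff_eq_C.1 (Nat.le_zero.1 hP)] at h
  have h1 := h x hx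
  have h2 := h y hy
  simp only [MvPolynomial.eval_C] at h1 h2
  rw [h1, h2]

/-- Nonlinear functions preserve piecewise constancy; this is what allows the exponential of the
discrete field in a test function. -/
theorem Mesh.mem_P0Sym_comp {ψ : Space d → Tensor d} (hψ : ψ ∈ M.P0Sym)
    {f : Tensor d → Tensor d} (hf : ∀ A : Tensor d, A.IsSymm → (f A).IsSymm) :
    (fun x => f (ψ x)) ∈ M.P0Sym := by
  refine ⟨fun i j K hK => ?_, fun K hK x hx => hf _ (hψ.2 K hK x hx)⟩
  obtain ⟨A, -, hA⟩ := M.exists_eqOn_const_of_mem_P0Sym hψ hK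
  exact ⟨MvPolynomial.C (f A i j), by simp, fun x hx => by simp [hA x hx]⟩

theorem Mesh.piecewiseContinuous_comp_of_mem_P0Sym {E : Type*} [TopologicalSpace E]
    {ψ : Space d → Tensor d} (hψ : ψ ∈ M.P0Sym) (f : Tensor d → E) :
    M.PiecewiseContinuous fun x => f (ψ x) := by
  intro K hK
  obtain ⟨A, -, hA⟩ := M.exists_eqOn_const_of_mem_P0Sym hψ hK
  exact ⟨fun _ => f A, continuous_const, fun x hx => by simp only [hA x hx]⟩

theorem Mesh.exists_polyField_eqOn {v : Space d → Space d} (hv : v ∈ M.P2Velocity)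
    {K : Set (Space d)} (hK : K ∈ M.elements) :
    ∃ P : Fin d → MvPolynomial (Fin d) ℝ, (∀ i, (P i).totalDegree ≤ 2) ∧
      EqOn v (polyField P) K := by
  choose P hP h using fun i => hv.2.1 i K hK
  refine ⟨P, hP, ?_⟩
  have h1 : EqOn v (polyField P) (interior K) := by
    intro x hx
    ext i
    exact h i x hx
  have h2 := h1.of_subset_closure (t := K) (hv.1.mono (M.element_subset hK))
    (continuous_polyField P).continuousOn interior_subset (M.closure_interior_element hK).ge
  exact h2

theorem Mesh.exists_hasFDerivAt_of_mem_P2Velocity {v : Space d → Space d}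
    (hv : v ∈ M.P2Velocity) {K : Set (Space d)} (hK : K ∈ M.elements) :
    ∃ P : Fin d → MvPolynomial (Fin d) ℝ, (∀ i, (P i).totalDegree ≤ 2) ∧
      ∀ x ∈ interior K, HasFDerivAt v (polyFieldDeriv P x) x := by
  obtain ⟨P, hP, h⟩ := M.exists_polyField_eqOn hv hK
  refine ⟨P, hP, fun x hx => (hasFDerivAt_polyField P x).congr_of_eventuallyEq ?_⟩
  filter_upwards [mem_interior_iff_mem_nhds.1 hx] with y hy using h hy

theorem Mesh.piecewiseContinuous_of_mem_P2Velocity {v : Space d → Space d}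
    (hv : v ∈ M.P2Velocity) : M.PiecewiseContinuous v := by
  intro K hK
  obtain ⟨P, -, h⟩ := M.exists_polyField_eqOn hv hK
  exact ⟨_, continuous_polyField P, h.mono interior_subset⟩

theorem Mesh.piecewiseContinuous_fderiv {v : Space d → Space d} (hv : v ∈ M.P2Velocity) :
    M.PiecewiseContinuous (fderiv ℝ v) := by
  intro K hK
  obtain ⟨P, -, h⟩ := M.exists_hasFDerivAt_of_mem_P2Velocity hv hK
  exact ⟨_, continuous_polyFieldDeriv P, fun x hx => (h x hx).fderiv⟩

theorem Mesh.piecewiseContinuous_grad {v : Space d → Space d} (hv : v ∈ M.P2Velocity) :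
    M.PiecewiseContinuous (grad v) := by
  refine .pi fun i => .pi fun j => (M.piecewiseContinuous_fderiv hv).comp
    (φ := fun L : Space d →L[ℝ] Space d => L (EuclideanSpace.single j 1) i) ?_
  fun_prop

theorem Mesh.div_mem_Pdisc {v : Space d → Space d} (hv : v ∈ M.P2Velocity) :
    div v ∈ M.Pdisc 1 := by
  intro K hK
  obtain ⟨P, hP, h⟩ := M.exists_hasFDerivAt_of_mem_P2Velocity hv hK
  refine ⟨∑ i, MvPolynomial.pderiv i (P i), ?_, fun x hx => ?_⟩
  · refine MvPolynomial.totalDegree_finsetSum_le fun i _ => ?_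
    have := totalDegree_pderiv_le i (P i)
    have := hP i
    omega
  · simp only [div, Matrix.trace, Matrix.diag_apply, grad, Matrix.of_apply, (h x hx).fderiv,
      polyFieldDeriv_single, map_sum, polyFun]

/-- Taking `q = div v` makes the integral of a square vanish. -/
theorem Mesh.div_ae_eq_zero {v : Space d → Space d} (hv : v ∈ M.P2Velocity)
    (h : ∀ q ∈ M.Pdisc 1, ∫ x in D, q x * div v x = 0) :
    ∀ᵐ x ∂volume.restrict D, div v x = 0 := by
  have hmem := M.div_mem_Pdisc hv
  have hpc := M.piecewiseContinuous_of_mem_Pdisc hmem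
  have hint : IntegrableOn (fun x => div v x * div v x) D :=
    (hpc.comp₂ hpc (φ := fun a b => a * b) (by fun_prop)).integrableOn
  have h0 := h _ hmem
  rw [integral_eq_zero_iff_of_nonneg (fun x => mul_self_nonneg _) hint] at h0
  filter_upwards [h0] with x hx
  exact mul_self_eq_zero.1 hx

/-! ### Extension of the velocity by zero -/

/-- The velocity is polynomial on each convex compact element, and the boundary condition makes the
extension by zero agree with that polynomial on the whole element. A globally defined field is
needed because Euler iterates may leave `D`. -/
theorem Mesh.exists_lipschitzWith_indicator (hD : IsOpen D) {v : Space d → Space d}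
    (hv : v ∈ M.P2Velocity) : ∃ C, LipschitzWith C (D.indicator v) := by
  have hK : ∀ K ∈ M.elements, ∃ C, LipschitzOnWith C (D.indicator v) K := by
    intro K hK
    obtain ⟨P, -, h⟩ := M.exists_polyField_eqOn hv hK
    have h' : EqOn (D.indicator v) (polyField P) K := by
      intro x hx
      rw [← h hx]
      by_cases hxD : x ∈ D
      · rw [indicator_of_mem hxD]
      · rw [indicator_of_notMem hxD, hv.2.2 x]
        exact ⟨M.element_subset hK hx, by rwa [hD.interior_eq]⟩
    obtain ⟨C, hC⟩ := (M.isCompact_element hK).exists_bound_of_continuousOn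
      (continuous_polyFieldDeriv P).continuousOn
    have hL : LipschitzOnWith C.toNNReal (polyField P) K := by
      refine (M.convex_element hK).lipschitzOnWith_of_nnnorm_hasFDerivWithin_le
        (fun x _ => (hasFDerivAt_polyField P x).hasFDerivWithinAt) fun x hx => ?_
      rw [← NNReal.coe_le_coe, coe_nnnorm]
      exact (hC x hx).trans (Real.le_coe_toNNReal C)
    refine ⟨C.toNNReal, fun x hx y hy => ?_⟩
    rw [h' hx, h' hy]
    exact hL hx hy
  choose! C hC using hK
  obtain ⟨B, hB⟩ := (M.elements_finite.image C).bddAbove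
  refine ⟨B, lipschitzWith_of_finite_closed_cover (S := insert Dᶜ M.elements)
    (M.elements_finite.insert _) ?_ ?_ ?_⟩
  · rintro A (rfl | hA)
    · exact hD.isClosed_compl
    · exact (M.isCompact_element hA).isClosed
  · intro x
    by_cases hx : x ∈ D
    · obtain ⟨K, hK, hxK⟩ := M.exists_mem_element (subset_closure hx)
      exact ⟨K, Or.inr hK, hxK⟩
    · exact ⟨Dᶜ, Or.inl rfl, hx⟩
  · rintro A (rfl | hA)
    · refine LipschitzOnWith.of_dist_le_mul fun x hx y hy => ?_
      rw [indicator_of_notMem hx, indicator_of_notMem hy, dist_self]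
      positivity
    · exact (hC A hA).weaken (hB (mem_image_of_mem _ hA))

theorem Mesh.hasCompactSupport_indicator (M : Mesh d D) {E : Type*} [Zero E] (v : Space d → E) :
    HasCompactSupport (D.indicator v) :=
  HasCompactSupport.intro M.isCompact_closure fun _ hx =>
    indicator_of_notMem (fun h => hx (subset_closure h)) _

end

end LogConf

namespace LogConf

noncomputable section

/-! ### Volume distortion of an explicit Euler step -/

/-- The linear term in `h` is the trace, which vanishes; the higher terms are bounded by counting
products of entries. -/
theorem exists_le_det_one_sub_smul {d : ℕ} (hd : d = 2 ∨ d = 3) (L : ℝ) :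
    ∃ C : ℝ, 0 ≤ C ∧ ∀ h : ℝ, 0 ≤ h → h ≤ 1 → ∀ G : Tensor d, (∀ i j, |G i j| ≤ L) →
      G.trace = 0 → 1 - C * h ^ 2 ≤ (1 - h • G).det := by
  have hprod : ∀ {a b A B : ℝ}, |a| ≤ A → |b| ≤ B → |a * b| ≤ A * B := by
    intro a b A B ha hb
    rw [abs_mul]
    exact mul_le_mul ha hb (abs_nonneg _) ((abs_nonneg _).trans ha)
  rcases hd with rfl | rfl
  · refine ⟨2 * L ^ 2, by positivity, fun h h0 h1 G hG htr => ?_⟩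
    have e : (1 - h • G).det
        = 1 - h * G.trace + h ^ 2 * (G 0 0 * G 1 1 - G 0 1 * G 1 0) := by
      simp [Matrix.det_fin_two, Matrix.trace_fin_two]
      ring
    have b1 := abs_le.1 (hprod (hG 0 0) (hG 1 1))
    have b2 := abs_le.1 (hprod (hG 0 1) (hG 1 0))
    have b3 : -(2 * L ^ 2) ≤ G 0 0 * G 1 1 - G 0 1 * G 1 0 := by nlinarith [b1.1, b2.2]
    rw [e, htr]
    nlinarith [mul_le_mul_of_nonneg_left b3 (sq_nonneg h)]
  -- Six products occur in the second-order minors and six in the determinant; `h ≤ 1` absorbs the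
  -- cubic term. The absolute value keeps the constant nonnegative before any `G` is available to
  -- show `0 ≤ L`.
  · refine ⟨6 * L ^ 2 + 6 * |L| ^ 3, by positivity, fun h h0 h1 G hG htr => ?_⟩
    have hL : |L| = L := abs_of_nonneg ((abs_nonneg _).trans (hG 0 0))
    have e : (1 - h • G).det
        = 1 - h * G.trace + h ^ 2 * (G 0 0 * G 1 1 - G 0 1 * G 1 0 + (G 0 0 * G 2 2 - G 0 2 * G 2 0)
          + (G 1 1 * G 2 2 - G 1 2 * G 2 1)) - h ^ 3 * G.det := by
      simp [Matrix.det_fin_three, Matrix.trace_fin_three]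
      ring
    have b1 := abs_le.1 (hprod (hG 0 0) (hG 1 1))
    have b2 := abs_le.1 (hprod (hG 0 1) (hG 1 0))
    have b3 := abs_le.1 (hprod (hG 0 0) (hG 2 2))
    have b4 := abs_le.1 (hprod (hG 0 2) (hG 2 0))
    have b5 := abs_le.1 (hprod (hG 1 1) (hG 2 2))
    have b6 := abs_le.1 (hprod (hG 1 2) (hG 2 1))
    have c : -(6 * L ^ 2) ≤ G 0 0 * G 1 1 - G 0 1 * G 1 0 + (G 0 0 * G 2 2 - G 0 2 * G 2 0)
          + (G 1 1 * G 2 2 - G 1 2 * G 2 1) := by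
      nlinarith [b1.1, b2.2, b3.1, b4.2, b5.1, b6.2]
    have c1 := abs_le.1 (hprod (hprod (hG 0 0) (hG 1 1)) (hG 2 2))
    have c2 := abs_le.1 (hprod (hprod (hG 0 0) (hG 1 2)) (hG 2 1))
    have c3 := abs_le.1 (hprod (hprod (hG 0 1) (hG 1 0)) (hG 2 2))
    have c4 := abs_le.1 (hprod (hprod (hG 0 1) (hG 1 2)) (hG 2 0))
    have c5 := abs_le.1 (hprod (hprod (hG 0 2) (hG 1 0)) (hG 2 1))
    have c6 := abs_le.1 (hprod (hprod (hG 0 2) (hG 1 1)) (hG 2 0))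
    have c7 : G.det ≤ 6 * L ^ 3 := by
      rw [Matrix.det_fin_three]
      have : L * L * L = L ^ 3 := by ring
      rw [this] at c1 c2 c3 c4 c5 c6
      linarith [c1.2, c2.1, c3.1, c4.2, c5.2, c6.1]
    rw [e, htr, hL]
    have hh : h ^ 3 ≤ h ^ 2 := by nlinarith [sq_nonneg h]
    have hL3 : 0 ≤ 6 * L ^ 3 := by rw [← hL]; positivity
    have k1 := mul_le_mul_of_nonneg_left c (sq_nonneg h)
    have k2 := mul_le_mul_of_nonneg_left c7 (by positivity : 0 ≤ h ^ 3)
    have k3 := mul_le_mul_of_nonneg_right hh hL3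
    nlinarith [k1, k2, k3]

theorem det_id_sub_smul {d : ℕ} (h : ℝ) (T : Space d →L[ℝ] Space d) :
    (ContinuousLinearMap.id ℝ (Space d) - h • T).det
      = (1 - h • Matrix.of fun i j => T (EuclideanSpace.single j 1) i : Tensor d).det := by
  rw [ContinuousLinearMap.det, ← LinearMap.det_toMatrix (EuclideanSpace.basisFun (Fin d) ℝ).toBasis]
  congr 1
  ext i j
  simp [LinearMap.toMatrix_apply, Matrix.one_apply]

theorem abs_grad_le {d : ℕ} {w : Space d → Space d} {L : NNReal} (hw : LipschitzWith L w)
    (x : Space d) (i j : Fin d) : |grad w x i j| ≤ L := by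
  have h1 := PiLp.norm_apply_le (fderiv ℝ w x (EuclideanSpace.single j 1)) i
  have h2 := (fderiv ℝ w x).le_opNorm (EuclideanSpace.single j 1)
  have h3 := norm_fderiv_le_of_lipschitz ℝ (x₀ := x) hw
  simp only [PiLp.norm_single, norm_one, mul_one] at h2
  exact (h1.trans h2).trans h3

/-- One step of the explicit Euler scheme for `dx/dt = -w x`. -/
def eulerStep {d : ℕ} (w : Space d → Space d) (h : ℝ) (x : Space d) : Space d := x - h • w x

theorem continuous_eulerStep {d : ℕ} {w : Space d → Space d} (hw : Continuous w) (h : ℝ) :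
    Continuous (eulerStep w h) := by
  unfold eulerStep
  fun_prop

/-- Area formula: a Lipschitz field is differentiable almost everywhere, and `h * L < 1` makes the
step injective, so the determinant bound integrates to a bound on volumes. -/
theorem exists_volume_le_volume_image_eulerStep {d : ℕ} (hd : d = 2 ∨ d = 3)
    {w : Space d → Space d} {L : NNReal} (hw : LipschitzWith L w) (hdiv : ∀ᵐ x, div w x = 0) :
    ∃ C : ℝ, 0 ≤ C ∧ ∀ h : ℝ, 0 ≤ h → h ≤ 1 → h * L < 1 → ∀ A : Set (Space d), IsCompact A →
      ENNReal.ofReal (1 - C * h ^ 2) * volume A ≤ volume (eulerStep w h '' A) := by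
  obtain ⟨C, hC0, hC⟩ := exists_le_det_one_sub_smul hd L
  refine ⟨C, hC0, fun h h0 h1 hL A hA => ?_⟩
  set s : Set (Space d) := A ∩ {x | DifferentiableAt ℝ w x} with hs
  have hsm : MeasurableSet s := hA.measurableSet.inter (measurableSet_of_differentiableAt ℝ w)
  have hsA : volume A = volume s := by
    refine measure_congr ?_
    filter_upwards [hw.ae_differentiableAt (μ := volume)] with x hx
    exact propext ⟨fun hxA => ⟨hxA, hx⟩, fun hxs => hxs.1⟩
  have hderiv : ∀ x ∈ s, HasFDerivWithinAt (eulerStep w h)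
      (ContinuousLinearMap.id ℝ (Space d) - h • fderiv ℝ w x) s x := fun x hx =>
    ((hasFDerivAt_id x).sub (hx.2.hasFDerivAt.const_smul h)).hasFDerivWithinAt
  have hinj : InjOn (eulerStep w h) s := by
    intro x _ y _ hxy
    have e : x - y = h • (w x - w y) := by
      have : x - h • w x = y - h • w y := hxy
      rw [smul_sub, sub_eq_sub_iff_add_eq_add]
      rw [sub_eq_sub_iff_add_eq_add] at this
      rw [this, add_comm]
    have n1 : ‖x - y‖ ≤ h * (L * ‖x - y‖) := by
      conv_lhs => rw [e, norm_smul, Real.norm_of_nonneg h0]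
      gcongr
      simpa [dist_eq_norm] using hw.dist_le_mul x y
    have n2 : ‖x - y‖ ≤ 0 := by
      by_contra hpos
      push Not at hpos
      nlinarith [mul_lt_mul_of_pos_right hL hpos]
    exact sub_eq_zero.1 (norm_le_zero_iff.1 n2)
  calc ENNReal.ofReal (1 - C * h ^ 2) * volume A
      = ∫⁻ _ in s, ENNReal.ofReal (1 - C * h ^ 2) := by rw [setLIntegral_const, hsA]
    _ ≤ ∫⁻ x in s, ENNReal.ofReal
          |(ContinuousLinearMap.id ℝ (Space d) - h • fderiv ℝ w x).det| := by
        refine lintegral_mono_ae (ae_restrict_of_ae ?_)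
        filter_upwards [hdiv] with x hx
        refine ENNReal.ofReal_le_ofReal (le_trans ?_ (le_abs_self _))
        rw [det_id_sub_smul]
        exact hC h h0 h1 (grad w x) (abs_grad_le hw x) hx
    _ = volume (eulerStep w h '' s) :=
        lintegral_abs_det_fderiv_eq_addHaar_image volume hsm hderiv hinj
    _ ≤ volume (eulerStep w h '' A) := measure_mono (image_mono inter_subset_left)

theorem pow_mul_volume_le_volume_iterate_image {d : ℕ} {f : Space d → Space d}
    (hf : Continuous f) {c : ENNReal}
    (h : ∀ A : Set (Space d), IsCompact A → c * volume A ≤ volume (f '' A))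
    {A : Set (Space d)} (hA : IsCompact A) (m : ℕ) :
    c ^ m * volume A ≤ volume (f^[m] '' A) := by
  induction m with
  | zero => simp
  | succ m ih =>
    rw [Function.iterate_succ', image_comp, pow_succ', mul_assoc]
    exact (mul_le_mul_right ih c).trans (h _ (hA.image (hf.iterate m)))

/-! ### Convergence of the Euler scheme to the backward flow -/

/-- Each step commits a local error `L * B * h ^ 2` and amplifies the earlier error by at most `1 +
L * h`. -/
theorem norm_eulerStep_iterate_sub_le {d : ℕ} {w : Space d → Space d} {L : NNReal}
    (hw : LipschitzWith L w) {B : ℝ} (hB : ∀ x, ‖w x‖ ≤ B) {t₀ t₁ : ℝ} {γ : ℝ → Space d}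
    (hγ : ∀ t ∈ Icc t₀ t₁, HasDerivWithinAt γ (w (γ t)) (Icc t₀ t₁) t) {h : ℝ} (h0 : 0 ≤ h)
    (k : ℕ) (hk : k * h ≤ t₁ - t₀) :
    ‖(eulerStep w h)^[k] (γ t₁) - γ (t₁ - k * h)‖ ≤ k * (L * B * h ^ 2) * (1 + L * h) ^ k := by
  have hB0 : 0 ≤ B := (norm_nonneg _).trans (hB 0)
  have hlip : ∀ r ∈ Icc t₀ t₁, ∀ s ∈ Icc t₀ t₁, ‖γ r - γ s‖ ≤ B * ‖r - s‖ := fun r hr s hs =>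
    (convex_Icc t₀ t₁).norm_image_sub_le_of_norm_hasDerivWithin_le hγ (fun t _ => hB _) hs hr
  have hstep : ∀ s, s ∈ Icc t₀ t₁ → s - h ∈ Icc t₀ t₁ →
      ‖eulerStep w h (γ s) - γ (s - h)‖ ≤ L * B * h ^ 2 := by
    intro s hs hsh
    have hsub : Icc (s - h) s ⊆ Icc t₀ t₁ := Icc_subset_Icc hsh.1 hs.2
    have hd : ∀ t ∈ Icc (s - h) s, HasDerivWithinAt (fun r => γ r - r • w (γ s))
        (w (γ t) - w (γ s)) (Icc (s - h) s) t := by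
      intro t ht
      have h2 := (hasDerivAt_id t).smul_const (w (γ s))
      rw [one_smul] at h2
      exact ((hγ t (hsub ht)).mono hsub).sub h2.hasDerivWithinAt
    have hb : ∀ t ∈ Icc (s - h) s, ‖w (γ t) - w (γ s)‖ ≤ L * (B * h) := by
      intro t ht
      have e1 := hw.dist_le_mul (γ t) (γ s)
      rw [dist_eq_norm, dist_eq_norm] at e1
      refine e1.trans ?_
      gcongr
      refine (hlip t (hsub ht) s hs).trans ?_
      gcongr
      rw [Real.norm_eq_abs, abs_le]
      constructor <;> linarith [ht.1, ht.2]
    have key := (convex_Icc (s - h) s).norm_image_sub_le_of_norm_hasDerivWithin_le hd hb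
      (left_mem_Icc.2 (by linarith)) (right_mem_Icc.2 (by linarith))
    have e : eulerStep w h (γ s) - γ (s - h)
        = γ s - s • w (γ s) - (γ (s - h) - (s - h) • w (γ s)) := by
      simp only [eulerStep, sub_smul]
      abel
    rw [e]
    refine key.trans (le_of_eq ?_)
    rw [sub_sub_cancel, Real.norm_of_nonneg h0]
    ring
  induction k with
  | zero => simp
  | succ k ih =>
    push_cast at hk ⊢
    have hk0 : 0 ≤ (k : ℝ) * h := by positivity
    have ih := ih (by linarith)
    have hs : t₁ - k * h ∈ Icc t₀ t₁ := ⟨by linarith, by linarith⟩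
    have hsh : t₁ - k * h - h ∈ Icc t₀ t₁ := ⟨by linarith, by linarith⟩
    have e1 := hstep _ hs hsh
    have e2 : t₁ - (k + 1) * h = t₁ - k * h - h := by ring
    set a := (eulerStep w h)^[k] (γ t₁)
    set b := γ (t₁ - k * h)
    have e3 : ‖eulerStep w h a - eulerStep w h b‖ ≤ (1 + L * h) * ‖a - b‖ := by
      have : eulerStep w h a - eulerStep w h b = (a - b) - h • (w a - w b) := by
        simp only [eulerStep, smul_sub]
        abel
      rw [this]
      refine (norm_sub_le _ _).trans ?_
      rw [norm_smul, Real.norm_of_nonneg h0]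
      have := hw.dist_le_mul a b
      rw [dist_eq_norm, dist_eq_norm] at this
      nlinarith [mul_le_mul_of_nonneg_left this h0]
    rw [Function.iterate_succ_apply', e2]
    have e4 := norm_sub_le_norm_sub_add_norm_sub (eulerStep w h a) (eulerStep w h b)
      (γ (t₁ - k * h - h))
    have hq : 1 ≤ 1 + L * h := le_add_of_nonneg_right (by positivity)
    have hp : 1 ≤ (1 + L * h) ^ (k + 1) := one_le_pow₀ hq
    have hc : 0 ≤ L * B * h ^ 2 := by positivity
    calc _ ≤ (1 + L * h) * (k * (L * B * h ^ 2) * (1 + L * h) ^ k) + L * B * h ^ 2 := by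
          refine e4.trans (add_le_add (e3.trans ?_) e1)
          gcongr
      _ ≤ (1 + L * h) * (k * (L * B * h ^ 2) * (1 + L * h) ^ k)
            + L * B * h ^ 2 * (1 + L * h) ^ (k + 1) := by
          linarith [le_mul_of_one_le_right hc hp]
      _ = _ := by ring

-- With `m` steps of size `τ / m` the accumulated error is `O(1 / m)`, uniformly in the starting
-- point. Exact trajectories stay in `D`, where `w` and `u` agree.
open Filter Topology in
theorem tendstoUniformlyOn_eulerStep_iterate {d : ℕ} {D : Set (Space d)} {w u : Space d → Space d}
    {L : NNReal} (hw : LipschitzWith L w) {B : ℝ} (hB : ∀ x, ‖w x‖ ≤ B) (hwu : EqOn w u D)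
    {t₀ t₁ : ℝ} (ht : t₀ ≤ t₁) {X : ℝ → Space d → Space d} (hX : IsBackwardFlow D u t₀ t₁ X) :
    TendstoUniformlyOn (fun m : ℕ => (eulerStep w ((t₁ - t₀) / m))^[m]) (X t₀) atTop D := by
  set τ := t₁ - t₀ with hτ
  have hτ0 : 0 ≤ τ := sub_nonneg.2 ht
  have hB0 : 0 ≤ B := (norm_nonneg _).trans (hB 0)
  have hbound : ∀ m : ℕ, 1 ≤ m → ∀ x ∈ D,
      ‖(eulerStep w (τ / m))^[m] x - X t₀ x‖ ≤ L * B * τ ^ 2 * Real.exp (L * τ) / m := by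
    intro m hm x hx
    have hm0 : (0 : ℝ) < m := by exact_mod_cast hm
    have hmτ : (m : ℝ) * (τ / m) = τ := by field_simp
    have key := norm_eulerStep_iterate_sub_le hw hB (γ := fun t => X t x) (t₀ := t₀) (t₁ := t₁)
      (h := τ / m) (fun t ht => by
        have := hX.ode x hx t ht
        rwa [← hwu (hX.mapsTo t ht x hx)] at this) (by positivity) m (by rw [hmτ])
    simp only [hmτ, hX.final x hx] at key
    rw [hτ, sub_sub_cancel, ← hτ] at key
    refine key.trans ?_
    have hexp : (1 + L * (τ / m)) ^ m ≤ Real.exp (L * τ) := by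
      have h1 : 1 + L * (τ / m) ≤ Real.exp (L * (τ / m)) := by
        linarith [Real.add_one_le_exp (L * (τ / m))]
      calc (1 + L * (τ / m)) ^ m ≤ Real.exp (L * (τ / m)) ^ m := by gcongr
        _ = Real.exp (L * τ) := by
          rw [← Real.exp_nat_mul]
          congr 1
          field_simp
    calc m * (L * B * (τ / m) ^ 2) * (1 + L * (τ / m)) ^ m
        ≤ m * (L * B * (τ / m) ^ 2) * Real.exp (L * τ) := by gcongr
      _ = _ := by field_simp
  rw [Metric.tendstoUniformlyOn_iff]
  intro δ hδ
  have hlim : Tendsto (fun m : ℕ => L * B * τ ^ 2 * Real.exp (L * τ) / m) atTop (𝓝 0) :=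
    tendsto_const_div_atTop_nhds_zero_nat _
  filter_upwards [hlim.eventually_lt_const hδ, eventually_ge_atTop 1] with m hm hm1 x hx
  rw [dist_comm, dist_eq_norm]
  exact (hbound m hm1 x hx).trans_lt hm

/-! ### The backward flow does not contract volumes -/

-- By Bernoulli, `m` Euler steps retain at least the fraction `1 - C * τ ^ 2 / m` of the volume, and
-- for large `m` their image lies in any given thickening of the compact set `X t₀ '' A`.
-- Thickenings of a compact set decrease to it in measure.
open Filter Topology in
theorem volume_le_volume_image_backwardFlow {d : ℕ} (hd : d = 2 ∨ d = 3) {D : Set (Space d)}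
    {w u : Space d → Space d} {L : NNReal} (hw : LipschitzWith L w) {B : ℝ} (hB : ∀ x, ‖w x‖ ≤ B)
    (hdiv : ∀ᵐ x, div w x = 0) (hwu : EqOn w u D) {t₀ t₁ : ℝ} (ht : t₀ ≤ t₁)
    {X : ℝ → Space d → Space d} (hX : IsBackwardFlow D u t₀ t₁ X) {A : Set (Space d)}
    (hA : IsCompact A) (hAD : A ⊆ D) : volume A ≤ volume (X t₀ '' A) := by
  have hunif := (tendstoUniformlyOn_eulerStep_iterate hw hB hwu ht hX).mono hAD
  obtain ⟨C, hC0, hC⟩ := exists_volume_le_volume_image_eulerStep hd hw hdiv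
  set τ := t₁ - t₀ with hτ
  have hτ0 : 0 ≤ τ := sub_nonneg.2 ht
  have hY : ContinuousOn (X t₀) A := hunif.continuousOn (Frequently.of_forall fun m =>
    ((continuous_eulerStep hw.continuous _).iterate m).continuousOn)
  have hYA : IsCompact (X t₀ '' A) := hA.image_of_continuousOn hY
  have hthick : ∀ δ > 0, volume A ≤ volume (Metric.cthickening δ (X t₀ '' A)) := by
    intro δ hδ
    have hlim : ∀ c : ℝ, Tendsto (fun m : ℕ => c / m) atTop (𝓝 0) :=
      fun c => tendsto_const_div_atTop_nhds_zero_nat c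
    have hlim2 : Tendsto (fun m : ℕ => ENNReal.ofReal (1 - C * τ ^ 2 / m) * volume A) atTop
        (𝓝 (volume A)) := by
      have h1 : Tendsto (fun m : ℕ => ENNReal.ofReal (1 - C * τ ^ 2 / m)) atTop (𝓝 1) := by
        have := ENNReal.tendsto_ofReal ((hlim (C * τ ^ 2)).const_sub 1)
        simpa using this
      simpa using ENNReal.Tendsto.mul_const h1 (Or.inl one_ne_zero)
    refine le_of_tendsto hlim2 ?_
    filter_upwards [Metric.tendstoUniformlyOn_iff.1 hunif δ hδ, eventually_ge_atTop 1,
      (hlim τ).eventually_lt_const one_pos, (hlim (τ * L)).eventually_lt_const one_pos,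
      (hlim (C * τ ^ 2)).eventually_lt_const one_pos] with m hm hm1 hm2 hm3 hm4
    have hm0 : (0 : ℝ) < m := by exact_mod_cast hm1
    have hm1' : (1 : ℝ) ≤ m := by exact_mod_cast hm1
    have hq : C * (τ / m) ^ 2 ≤ 1 := by
      refine le_trans ?_ hm4.le
      rw [div_pow, ← mul_div_assoc]
      exact div_le_div_of_nonneg_left (by positivity) hm0 (by nlinarith)
    have hbern : 1 - C * τ ^ 2 / m ≤ (1 - C * (τ / m) ^ 2) ^ m := by
      have := one_add_mul_le_pow (a := -(C * (τ / m) ^ 2)) (by linarith) m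
      rw [← sub_eq_add_neg] at this
      refine le_trans (le_of_eq ?_) this
      field_simp
      ring
    calc ENNReal.ofReal (1 - C * τ ^ 2 / m) * volume A
        ≤ ENNReal.ofReal (1 - C * (τ / m) ^ 2) ^ m * volume A := by
          rw [← ENNReal.ofReal_pow (by linarith)]
          gcongr
      _ ≤ volume ((eulerStep w (τ / m))^[m] '' A) :=
          pow_mul_volume_le_volume_iterate_image (continuous_eulerStep hw.continuous _)
            (hC (τ / m) (by positivity) hm2.le (by rwa [div_mul_eq_mul_div])) hA m
      _ ≤ volume (Metric.cthickening δ (X t₀ '' A)) := by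
          refine measure_mono ?_
          rintro _ ⟨x, hx, rfl⟩
          refine Metric.mem_cthickening_of_dist_le _ (X t₀ x) _ _ (mem_image_of_mem _ hx) ?_
          rw [dist_comm]
          exact (hm x hx).le
  have hlimδ : Tendsto (fun δ => volume (Metric.cthickening δ (X t₀ '' A))) (𝓝[>] 0)
      (𝓝 (volume (X t₀ '' A))) :=
    (tendsto_measure_cthickening_of_isCompact hYA).mono_left nhdsWithin_le_nhds
  exact ge_of_tendsto hlimδ (by
    filter_upwards [self_mem_nhdsWithin] with δ hδ using hthick δ hδ)

/-- Inner regularity reduces the preimage of `s` to compact subsets, whose images lie in `s ∩ D` and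
are no smaller. -/
theorem backwardFlow_aemeasurable_and_map_le {d : ℕ} (hd : d = 2 ∨ d = 3) {D : Set (Space d)}
    (hD : IsOpen D) {w u : Space d → Space d} {L : NNReal} (hw : LipschitzWith L w) {B : ℝ}
    (hB : ∀ x, ‖w x‖ ≤ B) (hdiv : ∀ᵐ x, div w x = 0) (hwu : EqOn w u D) {t₀ t₁ : ℝ}
    (ht : t₀ ≤ t₁) {X : ℝ → Space d → Space d} (hX : IsBackwardFlow D u t₀ t₁ X) :
    AEMeasurable (X t₀) (volume.restrict D) ∧
      Measure.map (X t₀) (volume.restrict D) ≤ volume.restrict D := by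
  have hY : ContinuousOn (X t₀) D :=
    (tendstoUniformlyOn_eulerStep_iterate hw hB hwu ht hX).continuousOn
      (Filter.Frequently.of_forall fun m =>
        ((continuous_eulerStep hw.continuous _).iterate m).continuousOn)
  have hYm := hY.aemeasurable (μ := volume) hD.measurableSet
  refine ⟨hYm, Measure.le_iff.2 fun s hs => ?_⟩
  have hE : MeasurableSet (D ∩ X t₀ ⁻¹' s) := by
    have h1 := hD.measurableSet.subtype_image
      ((continuousOn_iff_continuous_domRestrict.1 hY).measurable hs)
    convert h1 using 1
    ext x
    simp [and_comm]
  rw [Measure.map_apply_of_aemeasurable hYm hs, Measure.restrict_apply' hD.measurableSet,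
    inter_comm, Measure.restrict_apply hs, hE.measure_eq_iSup_isCompact]
  refine iSup₂_le fun A hA => iSup_le fun hAc => ?_
  refine (volume_le_volume_image_backwardFlow hd hw hB hdiv hwu ht hX hAc
    (hA.trans inter_subset_left)).trans (measure_mono ?_)
  rintro _ ⟨x, hx, rfl⟩
  exact ⟨(hA hx).2, hX.mapsTo t₀ (left_mem_Icc.2 ht) x (hA hx).1⟩

end

end LogConf

namespace LogConf

noncomputable section

variable {d : ℕ} {D : Set (Space d)} {M : Mesh d D}

/-! ### The convection term -/

theorem indicator_eventuallyEq {E : Type*} [Zero E] (hD : IsOpen D) (v : Space d → E)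
    {x : Space d} (hx : x ∈ D) : D.indicator v =ᶠ[nhds x] v := by
  filter_upwards [hD.mem_nhds hx] with y hy using indicator_of_mem hy v

theorem Mesh.exists_bound_indicator (hD : IsOpen D) {v : Space d → Space d}
    (hv : v ∈ M.P2Velocity) : ∃ B, ∀ x, ‖D.indicator v x‖ ≤ B := by
  obtain ⟨C, hC⟩ := M.exists_lipschitzWith_indicator hD hv
  exact (M.hasCompactSupport_indicator v).exists_bound_of_continuous hC.continuous

theorem Mesh.div_indicator_ae_eq_zero (hD : IsOpen D) {v : Space d → Space d}
    (hv : v ∈ M.P2VelocityDivFree) : ∀ᵐ x, div (D.indicator v) x = 0 := by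
  have h1 := (ae_restrict_iff' hD.measurableSet).1 (M.div_ae_eq_zero hv.1 hv.2)
  have h2 := measure_eq_zero_iff_ae_notMem.1 (M.volume_frontier hD)
  filter_upwards [h1, h2] with x hx hxf
  by_cases hxD : x ∈ D
  · rw [← hx hxD, div, div, grad, grad, (indicator_eventuallyEq hD v hxD).fderiv_eq]
  · have hxc : x ∉ closure D := fun h => hxf ⟨h, by rwa [hD.interior_eq]⟩
    have h0 : D.indicator v =ᶠ[nhds x] fun _ => 0 := by
      filter_upwards [isClosed_closure.isOpen_compl.mem_nhds hxc] with y hy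
      exact indicator_of_notMem (fun h => hy (subset_closure h)) v
    simp [div, grad, h0.fderiv_eq, Matrix.trace]

theorem Mesh.ae_differentiableAt (hD : IsOpen D) {v : Space d → Space d}
    (hv : v ∈ M.P2Velocity) : ∀ᵐ x ∂volume.restrict D, DifferentiableAt ℝ v x := by
  filter_upwards [M.ae_restrict_mem_interior hD] with x ⟨K, hK, hx⟩
  obtain ⟨P, -, h⟩ := M.exists_hasFDerivAt_of_mem_P2Velocity hv hK
  exact (h x hx).differentiableAt

theorem lipschitzWith_norm_sq {E F : Type*} [PseudoMetricSpace E] [SeminormedAddCommGroup F]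
    {f : E → F} {C : NNReal} (hf : LipschitzWith C f) {B : ℝ} (hB : ∀ x, ‖f x‖ ≤ B) :
    ∃ C', LipschitzWith C' fun x => ‖f x‖ ^ 2 := by
  refine ⟨(2 * B * C).toNNReal, LipschitzWith.of_dist_le' fun x y => ?_⟩
  have h1 := hf.dist_le_mul x y
  have h2 := abs_norm_sub_norm_le (f x) (f y)
  rw [← dist_eq_norm] at h2
  have e : ‖f x‖ ^ 2 - ‖f y‖ ^ 2 = (‖f x‖ + ‖f y‖) * (‖f x‖ - ‖f y‖) := by ring
  rw [Real.dist_eq, e, abs_mul, abs_of_nonneg (by positivity), mul_assoc (2 * B)]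
  have := hB x
  have := hB y
  exact mul_le_mul (by linarith) (h2.trans h1) (abs_nonneg _)
    (by linarith [norm_nonneg (f x)])

/-- Extended by zero, the fields are Lipschitz on the whole space, so integration by parts produces
neither boundary nor interelement terms. -/
theorem Mesh.integral_inner_fderiv_single (hD : IsOpen D) {u v : Space d → Space d}
    (hu : u ∈ M.P2Velocity) (hv : v ∈ M.P2Velocity) (i : Fin d) :
    ∫ x in D, 2 * inner ℝ (v x) (fderiv ℝ v x (EuclideanSpace.single i 1)) * u x i
      = ∫ x in D, -(grad u x i i * ‖v x‖ ^ 2) := by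
  obtain ⟨C, hC⟩ := M.exists_lipschitzWith_indicator hD hu
  obtain ⟨C', hC'⟩ := M.exists_lipschitzWith_indicator hD hv
  obtain ⟨B, hB⟩ := M.exists_bound_indicator hD hv
  obtain ⟨C'', hg⟩ := lipschitzWith_norm_sq hC' hB
  have hui : LipschitzWith C fun x => D.indicator u x i :=
    LipschitzWith.of_dist_le_mul fun x y => by
      refine le_trans ?_ (hC.dist_le_mul x y)
      rw [dist_eq_norm, dist_eq_norm]
      exact PiLp.norm_apply_le (D.indicator u x - D.indicator u y) i
  have hsupp : HasCompactSupport fun x => D.indicator u x i :=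
    (M.hasCompactSupport_indicator u).comp_left (g := fun y : Space d => y i) rfl
  have key := LipschitzWith.integral_lineDeriv_mul_eq (μ := volume) hg hui hsupp (EuclideanSpace.single i 1)
  have l1 := setIntegral_eq_integral_of_forall_compl_eq_zero (μ := volume) (s := D)
    (f := fun x => lineDeriv ℝ (fun x => ‖D.indicator v x‖ ^ 2) x (EuclideanSpace.single i 1)
      * D.indicator u x i) fun x hx => by simp [indicator_of_notMem hx]
  have l2 := setIntegral_eq_integral_of_forall_compl_eq_zero (μ := volume) (s := D)
    (f := fun x => lineDeriv ℝ (fun x => D.indicator u x i) x (-EuclideanSpace.single i 1)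
      * ‖D.indicator v x‖ ^ 2) fun x hx => by simp [indicator_of_notMem hx]
  rw [← l1, ← l2] at key
  refine Eq.trans ?_ (key.trans ?_)
  · refine integral_congr_ae ?_
    filter_upwards [M.ae_differentiableAt hD hv, ae_restrict_mem hD.measurableSet] with x hx hxD
    have h1 : HasFDerivAt (fun y => ‖D.indicator v y‖ ^ 2)
        (2 • (innerSL ℝ (v x)).comp (fderiv ℝ v x)) x := by
      refine hx.hasFDerivAt.norm_sq.congr_of_eventuallyEq ?_
      filter_upwards [indicator_eventuallyEq hD v hxD] with y hy
      rw [hy]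
    rw [(h1.hasLineDerivAt _).lineDeriv, indicator_of_mem hxD]
    simp
  · refine integral_congr_ae ?_
    filter_upwards [M.ae_differentiableAt hD hu, ae_restrict_mem hD.measurableSet] with x hx hxD
    have h1 : HasFDerivAt (fun y => D.indicator u y i)
        ((EuclideanSpace.proj i : Space d →L[ℝ] ℝ).comp (fderiv ℝ u x)) x := by
      refine ((EuclideanSpace.proj i : Space d →L[ℝ] ℝ).hasFDerivAt.comp x
        hx.hasFDerivAt).congr_of_eventuallyEq ?_
      filter_upwards [indicator_eventuallyEq hD u hxD] with y hy
      simp [hy]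
    rw [(h1.hasLineDerivAt _).lineDeriv, indicator_of_mem hxD]
    simp [grad]

/-- Summing the integrations by parts over the coordinates turns twice the integral into that of
`-(div u) |v|²`. -/
theorem Mesh.integral_convection_eq_zero (hD : IsOpen D) {u v : Space d → Space d}
    (hu : u ∈ M.P2VelocityDivFree) (hv : v ∈ M.P2Velocity) :
    ∫ x in D, inner ℝ (fderiv ℝ v x (u x)) (v x) = 0 := by
  have hpu := M.piecewiseContinuous_of_mem_P2Velocity hu.1
  have hpv := M.piecewiseContinuous_of_mem_P2Velocity hv
  have hdv := M.piecewiseContinuous_fderiv hv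
  have hgu := M.piecewiseContinuous_grad hu.1
  have hsum : ∀ x, ∑ i, 2 * inner ℝ (v x) (fderiv ℝ v x (EuclideanSpace.single i 1)) * u x i
      = 2 * inner ℝ (fderiv ℝ v x (u x)) (v x) := by
    intro x
    have hx : u x = ∑ i, u x i • EuclideanSpace.single i (1 : ℝ) := by
      ext j
      simp [Pi.single_apply]
    conv_rhs => rw [hx, map_sum, real_inner_comm, inner_sum, Finset.mul_sum]
    refine Finset.sum_congr rfl fun i _ => ?_
    rw [map_smul, inner_smul_right]
    ring
  have hint1 : ∀ i, IntegrableOn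
      (fun x => 2 * inner ℝ (v x) (fderiv ℝ v x (EuclideanSpace.single i 1)) * u x i) D := by
    intro i
    exact ((hpv.comp₂ hdv (φ := fun a (L : Space d →L[ℝ] Space d) =>
      2 * inner ℝ a (L (EuclideanSpace.single i 1))) (by fun_prop)).comp₂ hpu
        (φ := fun a b => a * b i) (by fun_prop)).integrableOn
  have hint2 : ∀ i, IntegrableOn (fun x => -(grad u x i i * ‖v x‖ ^ 2)) D := by
    intro i
    exact (hgu.comp₂ hpv (φ := fun (G : Tensor d) a => -(G i i * ‖a‖ ^ 2))
      (by fun_prop)).integrableOn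
  have h2 : ∫ x in D, 2 * inner ℝ (fderiv ℝ v x (u x)) (v x) = 0 := by
    simp only [← hsum]
    rw [integral_finsetSum _ fun i _ => hint1 i,
      Finset.sum_congr rfl fun i _ => M.integral_inner_fderiv_single hD hu.1 hv i,
      ← integral_finsetSum _ fun i _ => hint2 i]
    refine integral_eq_zero_of_ae ?_
    filter_upwards [M.div_ae_eq_zero hu.1 hu.2] with x hx
    rw [Finset.sum_neg_distrib, ← Finset.sum_mul]
    have : ∑ i, grad u x i i = 0 := hx
    simp [this]
  rw [integral_const_mul] at h2
  linarith

/-! ### Composition with a measure-nonincreasing map -/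

theorem integrable_comp_of_map_le {α : Type*} [MeasurableSpace α] {μ : Measure α} {Y : α → α}
    (hY : AEMeasurable Y μ) (hle : Measure.map Y μ ≤ μ) {f : α → ℝ} (hf : Integrable f μ) :
    Integrable (fun x => f (Y x)) μ :=
  (hf.mono_measure hle).comp_aemeasurable hY

theorem integral_comp_le_of_map_le {α : Type*} [MeasurableSpace α] {μ : Measure α} {Y : α → α}
    (hY : AEMeasurable Y μ) (hle : Measure.map Y μ ≤ μ) {f : α → ℝ} (hf : Integrable f μ)
    (h0 : 0 ≤ᵐ[μ] f) : ∫ x, f (Y x) ∂μ ≤ ∫ x, f x ∂μ := by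
  rw [← integral_map hY (hf.mono_measure hle).aestronglyMeasurable]
  exact integral_mono_measure hle h0 hf

/-! ### One time step -/

theorem continuous_ddot : Continuous fun p : Tensor d × Tensor d => ddot p.1 p.2 := by
  unfold ddot
  fun_prop

theorem ddot_smul_sub (c : ℝ) (A B C : Tensor d) :
    ddot (c • (A - B)) C = c * ddot A C - c * ddot B C := by
  simp only [ddot, Matrix.smul_mul, Matrix.sub_mul, Matrix.trace_smul, Matrix.trace_sub,
    smul_eq_mul, mul_sub]

/-- Composition with `Y` destroys the piecewise structure of `A`, so only integrability survives; it
is paired with the essential boundedness of `B`. -/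
theorem Mesh.integrableOn_ddot_comp (hD : IsOpen D) {Y : Space d → Space d}
    (hY : AEMeasurable Y (volume.restrict D))
    (hle : Measure.map Y (volume.restrict D) ≤ volume.restrict D) {A B : Space d → Tensor d}
    (hA : M.PiecewiseContinuous A) (hB : M.PiecewiseContinuous B) :
    IntegrableOn (fun x => ddot (A (Y x)) (B x)) D := by
  simp only [ddot_eq_sum]
  refine integrable_finsetSum _ fun i _ => integrable_finsetSum _ fun j _ => ?_
  have hAij := integrable_comp_of_map_le hY hle
    (hA.comp (φ := fun G : Tensor d => G i j) (by fun_prop)).integrableOn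
  have hBij := hB.comp (φ := fun G : Tensor d => G i j) (by fun_prop)
  obtain ⟨C, hC⟩ := hBij.ae_bounded hD
  exact hAij.mul_bdd hBij.integrableOn.aestronglyMeasurable hC

theorem Mesh.zero_mem_P2Velocity : (fun _ => 0) ∈ M.P2Velocity :=
  ⟨continuousOn_const, fun _ _ _ => ⟨0, by simp, fun x _ => by simp⟩, fun _ _ => rfl⟩

theorem Mesh.zero_mem_P0Sym : (fun _ => 0) ∈ M.P0Sym :=
  ⟨fun _ _ _ _ => ⟨0, by simp, fun x _ => by simp⟩, fun _ _ _ _ => Matrix.isSymm_zero⟩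

theorem grad_zero (x : Space d) : grad (fun _ : Space d => (0 : Space d)) x = 0 := by
  ext i j
  simp [grad]

theorem weakForm_zero_zero (Re Wi ε Δt : ℝ) (u₀ u₁ : Space d → Space d) (p₁ : Space d → ℝ)
    (ψ₀ ψ₁ : Space d → Tensor d) (Y : Space d → Space d) (Ω B : Space d → Tensor d)
    (q : Space d → ℝ) :
    weakForm D Re Wi ε Δt u₀ u₁ p₁ ψ₀ ψ₁ Y Ω B (fun _ => 0) q (fun _ => 0)
      = ∫ x in D, q x * div u₁ x := by
  simp [weakForm, div, grad_zero, ddot]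

/-- Polarization is the source of the numerical dissipation term in the velocity increment. -/
theorem inner_smul_sub_self_eq {E : Type*} [NormedAddCommGroup E] [InnerProductSpace ℝ E] (c : ℝ)
    (a b : E) :
    inner ℝ (c • (a - b)) a = c / 2 * (‖a‖ ^ 2 - ‖b‖ ^ 2 + ‖a - b‖ ^ 2) := by
  rw [real_inner_smul_left, inner_sub_left, norm_sub_sq_real, real_inner_self_eq_norm_sq,
    real_inner_comm]
  ring

theorem integral_energy_combination {α : Type*} [MeasurableSpace α] {μ : Measure α}
    {f₁ f₂ f₃ f₄ f₅ f₆ f₇ : α → ℝ} (a b c e : ℝ) (h₁ : Integrable f₁ μ) (h₂ : Integrable f₂ μ)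
    (h₃ : Integrable f₃ μ) (h₄ : Integrable f₄ μ) (h₅ : Integrable f₅ μ) (h₆ : Integrable f₆ μ)
    (h₇ : Integrable f₇ μ) :
    ∫ x, (a * f₁ x - a * f₂ x + b * f₃ x + c * f₄ x + f₅ x + e * f₆ x - e * f₇ x) ∂μ
      = a * (∫ x, f₁ x ∂μ) - a * (∫ x, f₂ x ∂μ) + b * (∫ x, f₃ x ∂μ) + c * (∫ x, f₄ x ∂μ)
        + (∫ x, f₅ x ∂μ) + e * (∫ x, f₆ x ∂μ) - e * (∫ x, f₇ x ∂μ) := by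
  rw [integral_sub (by fun_prop) (by fun_prop), integral_add (by fun_prop) (by fun_prop),
    integral_add (by fun_prop) (by fun_prop), integral_add (by fun_prop) (by fun_prop),
    integral_add (by fun_prop) (by fun_prop), integral_sub (by fun_prop) (by fun_prop)]
  simp only [integral_const_mul]

theorem Mesh.freeEnergy_step (hd : d = 2 ∨ d = 3) (hD : IsOpen D) {Re Wi ε τ : ℝ}
    (hWi : 0 < Wi) (hε : 0 ≤ ε) (hτ : 0 < τ) {u₀ u₁ : Space d → Space d}
    {p₁ : Space d → ℝ} {ψ₀ ψ₁ : Space d → Tensor d} (hu₀ : u₀ ∈ M.P2VelocityDivFree)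
    (hu₁ : u₁ ∈ M.P2VelocityDivFree) (hp₁ : p₁ ∈ M.Pdisc 1) (hψ₀ : ψ₀ ∈ M.P0Sym)
    (hψ₁ : ψ₁ ∈ M.P0Sym) {t₀ t₁ : ℝ} (ht : t₀ ≤ t₁) {X : ℝ → Space d → Space d}
    (hX : IsBackwardFlow D u₀ t₀ t₁ X) {Ω B N : Space d → Tensor d}
    (hdec : IsDecomposition M u₁ ψ₁ Ω B N)
    (hweak : ∀ v ∈ M.P2Velocity, ∀ q ∈ M.Pdisc 1, ∀ φ ∈ M.P0Sym,
      weakForm D Re Wi ε τ u₀ u₁ p₁ ψ₀ ψ₁ (X t₀) Ω B v q φ = 0) :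
    freeEnergy D Re Wi ε u₁ ψ₁ - freeEnergy D Re Wi ε u₀ ψ₀
        + (∫ x in D, Re / 2 * ‖u₁ x - u₀ x‖ ^ 2)
        + τ * (∫ x in D,
            ((1 - ε) * ddot (grad u₁ x) (grad u₁ x)
              + ε / (2 * Wi ^ 2) *
                (NormedSpace.exp (ψ₁ x) + NormedSpace.exp (-ψ₁ x)
                  - (2 : ℝ) • (1 : Tensor d)).trace)) ≤ 0 := by
  obtain ⟨L, hL⟩ := M.exists_lipschitzWith_indicator hD hu₀.1
  obtain ⟨b, hb⟩ := M.exists_bound_indicator hD hu₀.1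
  obtain ⟨hY, hle⟩ := backwardFlow_aemeasurable_and_map_le hd hD hL hb
    (M.div_indicator_ae_eq_zero hD hu₀) (fun x hx => indicator_of_mem hx u₀) ht hX
  set Y := X t₀
  -- This is the derivative of the elastic energy density with respect to `ψ`.
  set φ : Space d → Tensor d := fun x => (ε / (2 * Wi)) • (NormedSpace.exp (ψ₁ x) - 1) with hφdef
  have hφ : φ ∈ M.P0Sym := M.mem_P0Sym_comp hψ₁
    (f := fun A => (ε / (2 * Wi)) • (NormedSpace.exp A - 1))
    fun A hA => ((isSymm_exp hA).sub Matrix.isSymm_one).smul _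
  have h0 := hweak u₁ hu₁.1 p₁ hp₁ φ hφ
  -- regularity of the fields
  have cu₀ := M.piecewiseContinuous_of_mem_P2Velocity hu₀.1
  have cu₁ := M.piecewiseContinuous_of_mem_P2Velocity hu₁.1
  have cdu := M.piecewiseContinuous_fderiv hu₁.1
  have cg := M.piecewiseContinuous_grad hu₁.1
  have cdiv := M.piecewiseContinuous_of_mem_Pdisc (M.div_mem_Pdisc hu₁.1)
  have cp := M.piecewiseContinuous_of_mem_Pdisc hp₁
  have cΩ := M.piecewiseContinuous_of_mem_PdiscTensor hdec.Ω_mem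
  have cB := M.piecewiseContinuous_of_mem_PdiscTensor hdec.B_mem
  have cφ := M.piecewiseContinuous_of_mem_PdiscTensor hφ.1
  have cψ₀ := M.piecewiseContinuous_of_mem_PdiscTensor hψ₀.1
  have cψ₁ := M.piecewiseContinuous_of_mem_PdiscTensor hψ₁.1
  have cexp := M.piecewiseContinuous_comp_of_mem_P0Sym hψ₁
    (fun A => (NormedSpace.exp A : Tensor d))
  have cexpn := M.piecewiseContinuous_comp_of_mem_P0Sym hψ₁
    (fun A => (NormedSpace.exp (-A) - 1 : Tensor d))
  have cconv := cdu.comp₂ cu₀ (φ := fun (T : Space d →L[ℝ] Space d) a => T a) (by fun_prop)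
  -- integrability of the energy densities
  have i1 : IntegrableOn (fun x => ‖u₁ x‖ ^ 2) D :=
    (cu₁.comp (φ := fun a => ‖a‖ ^ 2) (by fun_prop)).integrableOn
  have i2 : IntegrableOn (fun x => ‖u₀ x‖ ^ 2) D :=
    (cu₀.comp (φ := fun a => ‖a‖ ^ 2) (by fun_prop)).integrableOn
  have i3 : IntegrableOn (fun x => Re / 2 * ‖u₁ x - u₀ x‖ ^ 2) D :=
    (cu₁.comp₂ cu₀ (φ := fun a b => Re / 2 * ‖a - b‖ ^ 2) (by fun_prop)).integrableOn
  have i4 : IntegrableOn (fun x => inner ℝ (fderiv ℝ u₁ x (u₀ x)) (u₁ x)) D :=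
    (cconv.comp₂ cu₁ (φ := fun a b => inner ℝ a b) (by fun_prop)).integrableOn
  have i5 : IntegrableOn (fun x => (1 - ε) * ddot (grad u₁ x) (grad u₁ x)
      + ε / (2 * Wi ^ 2) * (NormedSpace.exp (ψ₁ x) + NormedSpace.exp (-ψ₁ x)
        - (2 : ℝ) • (1 : Tensor d)).trace) D :=
    ((cg.comp₂ cg continuous_ddot).integrableOn.const_mul _).add
      ((M.piecewiseContinuous_comp_of_mem_P0Sym hψ₁ fun A => (NormedSpace.exp A
        + NormedSpace.exp (-A) - (2 : ℝ) • (1 : Tensor d)).trace).integrableOn.const_mul _)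
  have i6 : IntegrableOn (fun x => (NormedSpace.exp (ψ₁ x) - ψ₁ x - 1).trace) D :=
    (M.piecewiseContinuous_comp_of_mem_P0Sym hψ₁ fun A =>
      (NormedSpace.exp A - A - 1).trace).integrableOn
  have i7 : IntegrableOn (fun x => (NormedSpace.exp (ψ₀ x) - ψ₀ x - 1).trace) D :=
    (M.piecewiseContinuous_comp_of_mem_P0Sym hψ₀ fun A =>
      (NormedSpace.exp A - A - 1).trace).integrableOn
  have i8 : IntegrableOn (fun x => (NormedSpace.exp (ψ₀ (Y x)) - ψ₀ (Y x) - 1).trace) D :=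
    integrable_comp_of_map_le hY hle i7
  have iI : IntegrableOn (fun x =>
      Re * inner ℝ (τ⁻¹ • (u₁ x - u₀ x) + fderiv ℝ u₁ x (u₀ x)) (u₁ x)
      - p₁ x * div u₁ x + p₁ x * div u₁ x
      + (1 - ε) * ddot (grad u₁ x) (grad u₁ x)
      + ε / Wi * ddot (NormedSpace.exp (ψ₁ x)) (grad u₁ x)
      + ddot (τ⁻¹ • (ψ₁ x - ψ₀ (Y x))) (φ x)
      - ddot (Ω x * ψ₁ x - ψ₁ x * Ω x) (φ x)
      - 2 * ddot (B x) (φ x)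
      - 1 / Wi * ddot (NormedSpace.exp (-ψ₁ x) - 1) (φ x)) D := by
    have j1 := ((cu₁.comp₂ cu₀ (φ := fun a b => τ⁻¹ • (a - b)) (by fun_prop)).comp₂ cconv
      (φ := fun a b => a + b) (by fun_prop)).comp₂ cu₁
      (φ := fun a b => Re * inner ℝ a b) (by fun_prop)
    have j2 := cp.comp₂ cdiv (φ := fun a b => a * b) (by fun_prop)
    have j3 := cg.comp₂ cg continuous_ddot
    have j4 := cexp.comp₂ cg continuous_ddot
    have j5 := (cΩ.comp₂ cψ₁ (φ := fun A B : Tensor d => A * B - B * A) (by fun_prop)).comp₂ cφ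
      continuous_ddot
    have j6 := cB.comp₂ cφ continuous_ddot
    have j7 := cexpn.comp₂ cφ continuous_ddot
    have j8 := cψ₁.comp₂ cφ continuous_ddot
    have j9 := M.integrableOn_ddot_comp hD hY hle cψ₀ cφ
    simp only [ddot_smul_sub]
    exact (((((((j1.integrableOn.sub j2.integrableOn).add j2.integrableOn).add
      (j3.integrableOn.const_mul _)).add (j4.integrableOn.const_mul _)).add
      ((j8.integrableOn.const_mul _).sub (j9.const_mul _))).sub j5.integrableOn).sub
      (j6.integrableOn.const_mul _)).sub (j7.integrableOn.const_mul _)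
  have iJ : IntegrableOn (fun x => Re * τ⁻¹ / 2 * ‖u₁ x‖ ^ 2 - Re * τ⁻¹ / 2 * ‖u₀ x‖ ^ 2
      + τ⁻¹ * (Re / 2 * ‖u₁ x - u₀ x‖ ^ 2) + Re * inner ℝ (fderiv ℝ u₁ x (u₀ x)) (u₁ x)
      + ((1 - ε) * ddot (grad u₁ x) (grad u₁ x)
      + ε / (2 * Wi ^ 2) * (NormedSpace.exp (ψ₁ x) + NormedSpace.exp (-ψ₁ x)
        - (2 : ℝ) • (1 : Tensor d)).trace)
      + ε / (2 * Wi) * τ⁻¹ * (NormedSpace.exp (ψ₁ x) - ψ₁ x - 1).trace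
      - ε / (2 * Wi) * τ⁻¹ * (NormedSpace.exp (ψ₀ (Y x)) - ψ₀ (Y x) - 1).trace) D :=
    ((((((i1.const_mul _).sub (i2.const_mul _)).add (i3.const_mul _)).add (i4.const_mul _)).add
      i5).add (i6.const_mul _)).sub (i8.const_mul _)
  have hsymm₀ : ∀ᵐ x ∂volume.restrict D, (ψ₀ x).IsSymm := by
    filter_upwards [M.ae_restrict_mem_interior hD] with x ⟨K, hK, hx⟩ using hψ₀.2 K hK x hx
  -- Symmetry of `ψ₀` is known only off the mesh skeleton; the bound on the pushforward ensures that
  -- almost no characteristic foot lands there.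
  have hsymmY : ∀ᵐ x ∂volume.restrict D, (ψ₀ (Y x)).IsSymm :=
    ae_of_ae_map hY ((Measure.absolutelyContinuous_of_le hle).ae_le hsymm₀)
  -- The energy balance, still with `ψ₀` at the feet and with the convection term, is a pointwise
  -- lower bound for the tested integrand, whose integral is zero.
  have hmono := integral_mono_ae iJ iI (by
    filter_upwards [M.ae_restrict_mem_interior hD, hsymmY, M.div_ae_eq_zero hu₁.1 hu₁.2]
      with x ⟨K, hK, hx⟩ hs hdiv
    have key := stress_balance_le hε hWi (inv_nonneg.2 hτ.le) (hψ₁.2 K hK x hx) hs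
      (hdec.Ω_antisymm K hK x hx) (hdec.N_antisymm K hK x hx) (hdec.eq K hK x hx) hdiv
    simp only [inner_add_left, inner_smul_sub_self_eq]
    simp only [hφdef]
    linarith)
  replace hmono := hmono.trans_eq h0
  have hflow : ∫ x in D, (NormedSpace.exp (ψ₀ (Y x)) - ψ₀ (Y x) - 1).trace
      ≤ ∫ x in D, (NormedSpace.exp (ψ₀ x) - ψ₀ x - 1).trace :=
    integral_comp_le_of_map_le hY hle i7 (by
      filter_upwards [hsymm₀] with x hx using trace_exp_sub_sub_one_nonneg hx)
  have hlin := (integral_energy_combination (Re * τ⁻¹ / 2) τ⁻¹ Re (ε / (2 * Wi) * τ⁻¹)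
    i1 i2 i3 i4 i5 i6 i8).ge.trans hmono
  rw [M.integral_convection_eq_zero hD hu₀ hu₁.1] at hlin
  have hτlin := mul_le_mul_of_nonneg_left hlin hτ.le
  have hflow' := mul_le_mul_of_nonneg_left hflow (by positivity : 0 ≤ ε / (2 * Wi))
  rw [freeEnergy, freeEnergy]
  simp only [mul_add, mul_sub, ← mul_assoc, mul_zero, add_zero] at hτlin
  have e1 : τ * Re * τ⁻¹ / 2 = Re / 2 := by field_simp
  have e2 : τ * (Re * τ⁻¹ / 2) = Re / 2 := by field_simp
  have e3 : τ * (ε / (2 * Wi)) * τ⁻¹ = ε / (2 * Wi) := by field_simp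
  have e4 : τ * τ⁻¹ = 1 := mul_inv_cancel₀ hτ.ne'
  simp only [e2, e3, e4, one_mul] at hτlin
  linarith

end

end LogConf

theorem mainTheorem3 (d : ℕ) (hd : d = 2 ∨ d = 3)
    (D : Set (LogConf.Space d)) (hD : IsOpen D) (M : LogConf.Mesh d D)
    (Re Wi ε T : ℝ) (hRe : 0 ≤ Re) (hWi : 0 < Wi) (hε0 : 0 ≤ ε) (hε1 : ε < 1) (hT : 0 < T)
    (NT : ℕ)
    (u : ℕ → LogConf.Space d → LogConf.Space d) (p : ℕ → LogConf.Space d → ℝ)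
    (ψ : ℕ → LogConf.Space d → LogConf.Tensor d)
    (hu0 : u 0 ∈ M.P2VelocityDivFree)
    (hsol : LogConf.IsSolution M Re Wi ε T NT u p ψ) :
    (∀ n < NT,
      LogConf.freeEnergy D Re Wi ε (u (n + 1)) (ψ (n + 1))
          - LogConf.freeEnergy D Re Wi ε (u n) (ψ n)
        + (∫ x in D, Re / 2 * ‖u (n + 1) x - u n x‖ ^ 2)
        + T / NT * (∫ x in D,
            ((1 - ε) * LogConf.ddot (LogConf.grad (u (n + 1)) x) (LogConf.grad (u (n + 1)) x)
              + ε / (2 * Wi ^ 2) *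
                (NormedSpace.exp (ψ (n + 1) x) + NormedSpace.exp (-ψ (n + 1) x)
                  - (2 : ℝ) • (1 : LogConf.Tensor d)).trace))
        ≤ 0) ∧
    ∀ m n : ℕ, m ≤ n → n ≤ NT →
      LogConf.freeEnergy D Re Wi ε (u n) (ψ n) ≤ LogConf.freeEnergy D Re Wi ε (u m) (ψ m) := by
  -- Only the initial velocity needs an assumption: for later ones, testing with `v = 0` and `φ = 0`
  -- isolates the constraint.
  have hdiv : ∀ n ≤ NT, u n ∈ M.P2VelocityDivFree := by
    intro n hn
    rcases n with _ | n
    · exact hu0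
    · refine ⟨hsol.u_mem _ hn, fun q hq => ?_⟩
      obtain ⟨X, Ω, B, N, -, -, hweak⟩ := hsol.step n hn
      rw [← hweak _ M.zero_mem_P2Velocity q hq _ M.zero_mem_P0Sym, LogConf.weakForm_zero_zero]
  -- Lets the proof of monotonicity use the energy inequality just established; what remains there
  -- is the sign of the dissipation.
  have and_intro : ∀ {P Q : Prop}, P → (P → Q) → P ∧ Q := fun h h' => ⟨h, h' h⟩
  refine and_intro (fun n hn => ?_) fun hstep m n hmn =>
    Nat.le_induction (fun _ => le_rfl) (fun k _ ih hk => ?_) n hmn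
  · obtain ⟨X, Ω, B, N, hX, hdec, hweak⟩ := hsol.step n hn
    have hτ : 0 < T / NT := div_pos hT (by exact_mod_cast (Nat.zero_le n).trans_lt hn)
    exact M.freeEnergy_step hd hD (Re := Re) hWi hε0 hτ (hdiv n hn.le) (hdiv (n + 1) hn)
      (hsol.p_mem _ hn) (hsol.ψ_mem n hn.le) (hsol.ψ_mem (n + 1) hn) (by nlinarith) hX hdec hweak
  have hτ : 0 ≤ T / NT := by positivity
  have h1 : 0 ≤ ∫ x in D, Re / 2 * ‖u (k + 1) x - u k x‖ ^ 2 :=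
    integral_nonneg fun x => by positivity
  have h2 := integral_nonneg_of_ae (μ := volume.restrict D) (f := fun x =>
      (1 - ε) * LogConf.ddot (LogConf.grad (u (k + 1)) x) (LogConf.grad (u (k + 1)) x)
        + ε / (2 * Wi ^ 2) *
          (NormedSpace.exp (ψ (k + 1) x) + NormedSpace.exp (-ψ (k + 1) x)
            - (2 : ℝ) • (1 : LogConf.Tensor d)).trace) (by
    filter_upwards [M.ae_restrict_mem_interior hD] with x ⟨K, hK, hx⟩
    refine add_nonneg (mul_nonneg (sub_nonneg.2 hε1.le) ?_) (mul_nonneg (by positivity)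
      (LogConf.trace_exp_add_exp_neg_nonneg ((hsol.ψ_mem (k + 1) hk).2 K hK x hx)))
    rw [LogConf.ddot_eq_sum]
    exact Finset.sum_nonneg fun i _ => Finset.sum_nonneg fun j _ => mul_self_nonneg _)
  have h3 := mul_nonneg hτ h2
  linarith [hstep k hk, ih (Nat.le_of_succ_le hk)]
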